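/- Let $d$ be the number of covariates, let $X$ be a random vector in $\mathbb{R}^d$ with value space $\mathcal X$ (so $X\in\mathcal X$ almost surely) and let $Y$ be a real random variable. For $x\in\mathcal X$ suppose that the distribution function $F_x$ of the conditional distribution of $Y$ given $X=x$ is continuous and strictly increasing on $(0,\infty)$, with $F_x(y)=0$ for $y\le 0$. Put $Z=\log Y$ and suppose that for $x\in\mathcal X$, $p\in(0,1)$ the quantile function of $Z$ given $X=x$ is $$\beta_0(p)+\beta_1(p)x_1+\dots+\beta_d(p)x_d,$$ where each $\beta_i$ is nondecreasing and continuous on $[\eta,1-\eta]$ for every $\eta\in(0,\tfrac12)$. Let $Q_x(p)=\inf\{t: F_x(t)\ge p\}$ be the quantile function of $Y$ given $X=x$ (thus $Q_x=\exp(\beta_0+\sum_i\beta_ix_i)$), and for a positive function $Q$ on $(0,1)$ put $$qZ(p;Q)=1-\frac{Q(p/2)}{Q(1/2+p/2)},\qquad p\in(0,1).$$ Let $(X^{(1)},Y^{(1)}),(X^{(2)},Y^{(2)}),\dots$ be independent copies of $(X,Y)$ and $Z^{(k)}=\log Y^{(k)}$. Assume: * (A1) the distribution of $X$ is absolutely continuous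 with support set $V\subset\mathbb{R}^d$, $0\in V$, and has a density that is positive on $V$ and, as a function on $V$, continuous at $0$; * (A2) for every $x\in\mathcal X$ the conditional distribution of $Z$ given $X=x$ has a density that is Hölder continuous in an open neighbourhood of $0$; * (A3) $\frac1n \mathbf X^{*T}\mathbf X^{*}\to A$ in probability as $n\to\infty$ for some positive definite matrix $A$, where $\mathbf X^*$ is the $n\times(d+1)$ matrix with rows $(1,X^{(k)}_1,\dots,X^{(k)}_d)$, $k=1,\dots,n$. Let $\rho_p(u)=u\,(p-\mathbb 1(u<0))$. For $m,n\in\mathbb N$ let $\hat\beta^{(m,n)}$ be the (ordinary quantile regression, OQR) estimator such that for $j=1,\dots,m-1$ the vector $\hat\beta^{(m,n)}(j/m)$ is any minimiser over $b\in\mathbb R^{d+1}$ of $$\sum_{k=1}^n\rho_{j/m}\Big(Z^{(k)}-b_0-\sum_{i=1}^d b_iX_i^{(k)}\Big),$$ and each $\hat\beta_i^{(m,n)}$ is linearly interpolated on $[\frac1m,\frac{m-1}m]$ between these values. Let $\tilde\beta^{(m,n)}$ be the isotonised (IOQR) estimator: for each $i$, $\tilde\beta_i^{(m,n)}(\frac1m)\le\dots\le\tilde\beta_i^{(m,n)}(\frac{m-1}m)$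 is the nondecreasing sequence minimising $\sum_{j=1}^{m-1}[\tilde\beta_i^{(m,n)}(j/m)-\hat\beta_i^{(m,n)}(j/m)]^2$, again linearly interpolated. (The values outside $[\frac1m,\frac{m-1}m]$ are arbitrary.) Put $\hat Q_x^{(m,n)}=\exp(\hat\beta_0^{(m,n)}+\sum_i\hat\beta_i^{(m,n)}x_i)$ and $\tilde Q_x^{(m,n)}=\exp(\tilde\beta_0^{(m,n)}+\sum_i\tilde\beta_i^{(m,n)}x_i)$. Then for every $\eta\in(0,\tfrac12)$ and every $x\in\mathcal X$, as $m,n\to\infty$ jointly (without any relation between $m$ and $n$): 1. $\sup_{p\in[\eta,1-\eta]}|\hat\beta^{(m,n)}(p)-\beta(p)|\to0$ in probability; 2. $\sup_{p\in[\eta,1-\eta]}|\hat Q_x^{(m,n)}(p)-Q_x(p)|\to0$ in probability; 3. $\sup_{p\in[\eta,1-\eta]}|qZ(p;\hat Q_x^{(m,n)})-qZ(p;Q_x)|\to0$ in probability; 4. $\int_\eta^{1-\eta}qZ(p;\hat Q_x^{(m,n)})\,dp\to\int_\eta^{1-\eta}qZ(p;Q_x)\,dp$ in probability. If in addition $\mathbb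 E|\log Y|<\infty$, then 1–4 also hold with $\tilde\beta^{(m,n)}$, $\tilde Q_x^{(m,n)}$ in place of $\hat\beta^{(m,n)}$, $\hat Q_x^{(m,n)}$. -/

import Mathlib

open MeasureTheory ProbabilityTheory Filter Set
open scoped Topology ENNReal NNReal

namespace CondQuantile

noncomputable section

/-! ### Quantile functions, the curve `qZ`, and the linear predictor -/

/-- The quantile function `Q(p) = inf {t : F(t) ≥ p}` of a probability measure on `ℝ`
with distribution function `F`. -/
def quantile (μ : Measure ℝ) (p : ℝ) : ℝ := sInf {t : ℝ | p ≤ cdf μ t}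

/-- The quantile inequality curve `qZ(p; Q) = 1 - Q(p/2) / Q(1/2 + p/2)` for `p ∈ (0,1)`,
with the value `1` at `p = 0` and `p = 1`. -/
def qZ (Q : ℝ → ℝ) (p : ℝ) : ℝ :=
  if p = 0 ∨ p = 1 then 1 else 1 - Q (p / 2) / Q (1 / 2 + p / 2)

/-- The linear predictor `b₀ + b₁ x₁ + ⋯ + b_d x_d`. -/
def linPred {d : ℕ} (b : Fin (d + 1) → ℝ) (x : Fin d → ℝ) : ℝ :=
  b 0 + ∑ i : Fin d, b i.succ * x i

/-- The function `p ↦ exp (β₀(p) + β₁(p) x₁ + ⋯ + β_d(p) x_d)`; for an estimator of `β` in the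
place of `β` it is the plug-in estimator of the conditional quantile function `Q_x`. -/
def plugInQ {d : ℕ} (b : ℝ → Fin (d + 1) → ℝ) (x : Fin d → ℝ) (p : ℝ) : ℝ :=
  Real.exp (linPred (b p) x)

/-! ### The model -/

/-- The linear-in-covariates model for the conditional log-quantile function: `κ x` is the
conditional distribution of `Y` given `X = x`, and `𝒳` is the value space of `X`. -/
structure LogLinearQuantileModel {Ω₀ : Type*} [MeasurableSpace Ω₀] (P₀ : Measure Ω₀) {d : ℕ}
    (X : Ω₀ → Fin d → ℝ) (Y : Ω₀ → ℝ) (κ : Kernel (Fin d → ℝ) ℝ) (𝒳 : Set (Fin d → ℝ))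
    (β : ℝ → Fin (d + 1) → ℝ) : Prop where
  measurable_X : Measurable X
  measurable_Y : Measurable Y
  condDistrib : HasCondDistrib Y X κ P₀
  mem_values : ∀ᵐ ω ∂P₀, X ω ∈ 𝒳
  cdf_continuous : ∀ x ∈ 𝒳, ContinuousOn (cdf (κ x)) (Ioi 0)
  cdf_increasing : ∀ x ∈ 𝒳, StrictMonoOn (cdf (κ x)) (Ioi 0)
  cdf_nonpos : ∀ x ∈ 𝒳, ∀ y ≤ 0, cdf (κ x) y = 0
  /-- The quantile function of `Z = log Y` given `X = x` is `β₀(p) + β₁(p) x₁ + ⋯ + β_d(p) x_d`. -/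
  log_quantile : ∀ x ∈ 𝒳, ∀ p ∈ Ioo (0 : ℝ) 1,
    quantile ((κ x).map Real.log) p = linPred (β p) x
  coef_monotone : ∀ i, ∀ η ∈ Ioo (0 : ℝ) (1 / 2), MonotoneOn (fun p => β p i) (Icc η (1 - η))
  coef_continuous : ∀ i, ∀ η ∈ Ioo (0 : ℝ) (1 / 2), ContinuousOn (fun p => β p i) (Icc η (1 - η))

/-- Assumption (A1): the covariate law is absolutely continuous with support set `V ∋ 0`; its
density is positive on `V` and continuous at `0` (as a function on `V`). -/
def CovariateDensity {d : ℕ} (law : Measure (Fin d → ℝ)) : Prop :=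
  ∃ (V : Set (Fin d → ℝ)) (f : (Fin d → ℝ) → ℝ), MeasurableSet V ∧ Measurable f ∧ 0 ∈ V ∧
    law = (volume.restrict V).withDensity (fun x => ENNReal.ofReal (f x)) ∧
    (∀ x ∈ V, 0 < f x) ∧ ContinuousWithinAt f V 0

/-- Assumption (A2): for every `x ∈ 𝒳` the conditional distribution of `Z = log Y` given `X = x`
has a density that is Hölder continuous in an open neighbourhood of `0`. -/
def HolderLogDensity {d : ℕ} (κ : Kernel (Fin d → ℝ) ℝ) (𝒳 : Set (Fin d → ℝ)) : Prop :=
  ∀ x ∈ 𝒳, ∃ g : ℝ → ℝ, Measurable g ∧ (∀ z, 0 ≤ g z) ∧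
    (κ x).map Real.log = volume.withDensity (fun z => ENNReal.ofReal (g z)) ∧
    ∃ U : Set ℝ, IsOpen U ∧ 0 ∈ U ∧ ∃ C r : ℝ≥0, 0 < r ∧ r ≤ 1 ∧ HolderOnWith C r g U

/-- The `n × (d+1)` design matrix: a column of ones followed by the covariates. -/
def designMatrix {d : ℕ} (n : ℕ) (xs : ℕ → Fin d → ℝ) : Matrix (Fin n) (Fin (d + 1)) ℝ :=
  Matrix.of fun k => Fin.cons 1 (xs k)

/-- Assumption (A3): `(1/n) X*ᵀ X*` converges in probability (entrywise) to a positive definite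
matrix. -/
def DesignConverges {Ω : Type*} [MeasurableSpace Ω] (P : Measure Ω) {d : ℕ}
    (Xs : ℕ → Ω → Fin d → ℝ) : Prop :=
  ∃ A : Matrix (Fin (d + 1)) (Fin (d + 1)) ℝ, A.PosDef ∧ ∀ i j,
    TendstoInMeasure P
      (fun (n : ℕ) ω => ((n : ℝ)⁻¹ • ((designMatrix n fun k => Xs k ω).transpose *
        designMatrix n fun k => Xs k ω)) i j)
      atTop (fun _ => A i j)

/-! ### The estimators -/

/-- The quantile regression loss `ρ_p(u) = u (p - 𝟙(u < 0))`. -/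
def rho (p u : ℝ) : ℝ := u * (p - if u < 0 then 1 else 0)

/-- `b` minimises `b ↦ ∑_{k < n} ρ_p (z_k - b ⬝ (1, x_k))`. -/
def IsOQRCoef {d : ℕ} (n : ℕ) (xs : ℕ → Fin d → ℝ) (zs : ℕ → ℝ) (p : ℝ)
    (b : Fin (d + 1) → ℝ) : Prop :=
  ∀ b' : Fin (d + 1) → ℝ, ∑ k ∈ Finset.range n, rho p (zs k - linPred b (xs k)) ≤
    ∑ k ∈ Finset.range n, rho p (zs k - linPred b' (xs k))

/-- On `[1/m, (m-1)/m]` the function `f` is the linear interpolation between its values at the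
points `1/m, …, (m-1)/m`. Nothing is required outside this interval. -/
def IsLinearInterpolation (m : ℕ) (f : ℝ → ℝ) : Prop :=
  ∀ j : ℕ, 1 ≤ j → j + 1 < m → ∀ p ∈ Icc ((j : ℝ) / m) (((j + 1 : ℕ) : ℝ) / m),
    f p = f ((j : ℝ) / m) + (p - (j : ℝ) / m) *
      ((f (((j + 1 : ℕ) : ℝ) / m) - f ((j : ℝ) / m)) / (((j + 1 : ℕ) : ℝ) / m - (j : ℝ) / m))

/-- `b : ℝ → ℝ^{d+1}` is a linearly interpolated OQR estimate on the grid `1/m, …, (m-1)/m` from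
the observations `(x_k, z_k)`, `k < n`. -/
def IsOQREstimate {d : ℕ} (m n : ℕ) (xs : ℕ → Fin d → ℝ) (zs : ℕ → ℝ)
    (b : ℝ → Fin (d + 1) → ℝ) : Prop :=
  (∀ j ∈ Finset.Ico 1 m, IsOQRCoef n xs zs ((j : ℝ) / m) (b ((j : ℝ) / m))) ∧
    ∀ i, IsLinearInterpolation m fun p => b p i

/-- `u₁ ≤ ⋯ ≤ u_{m-1}` is the isotonic regression, with unit weights, of `v₁, …, v_{m-1}`. -/
def IsIsotonicRegression (m : ℕ) (v u : ℕ → ℝ) : Prop :=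
  MonotoneOn u (Finset.Ico 1 m) ∧ ∀ w : ℕ → ℝ, MonotoneOn w (Finset.Ico 1 m) →
    ∑ j ∈ Finset.Ico 1 m, (u j - v j) ^ 2 ≤ ∑ j ∈ Finset.Ico 1 m, (w j - v j) ^ 2

/-- `b'` is the isotonised estimate (IOQR) obtained from the OQR estimate `b`: coordinatewise
isotonic regression of the grid values, followed by linear interpolation. -/
def IsIsotonised {d : ℕ} (m : ℕ) (b b' : ℝ → Fin (d + 1) → ℝ) : Prop :=
  ∀ i, IsIsotonicRegression m (fun j => b ((j : ℝ) / m) i) (fun j => b' ((j : ℝ) / m) i) ∧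
    IsLinearInterpolation m fun p => b' p i

/-! ### Convergence -/

/-- As `m, n → ∞` jointly, `F m n → f` in probability, uniformly on `S`: for all `ε > 0`,
`P (sup_{p ∈ S} dist (F m n p) (f p) ≥ ε) → 0`. The supremum is taken in `[0, ∞]`, and `P` is read
as an outer measure where measurability is not known. -/
def TendstoInProbUniformlyOn {Ω E : Type*} [MeasurableSpace Ω] [PseudoEMetricSpace E]
    (P : Measure Ω) (F : ℕ → ℕ → Ω → ℝ → E) (f : ℝ → E) (S : Set ℝ) : Prop :=
  ∀ ε : ℝ≥0∞, 0 < ε → Tendsto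
    (fun mn : ℕ × ℕ => P {ω | ε ≤ ⨆ p ∈ S, edist (F mn.1 mn.2 ω p) (f p)})
    (atTop ×ˢ atTop) (𝓝 0)

/-- The consistency properties of an estimator `b` of `β`: for each `η ∈ (0, 1/2)`, convergence in
probability, uniformly on `[η, 1-η]`, of `b` to `β` and, for each `x ∈ 𝒳`, of the plug-in
estimators of `Q_x` and of `qZ(·; Q_x)`, where `Q_x` is the quantile function of `κ x`; and
convergence in probability of the integral over `[η, 1-η]` of the plug-in estimator of `qZ`. -/
def Consistent {Ω : Type*} [MeasurableSpace Ω] (P : Measure Ω) {d : ℕ}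
    (κ : Kernel (Fin d → ℝ) ℝ) (𝒳 : Set (Fin d → ℝ)) (β : ℝ → Fin (d + 1) → ℝ)
    (b : ℕ → ℕ → Ω → ℝ → Fin (d + 1) → ℝ) : Prop :=
  ∀ η ∈ Ioo (0 : ℝ) (1 / 2),
    TendstoInProbUniformlyOn P b β (Icc η (1 - η)) ∧
    ∀ x ∈ 𝒳,
      TendstoInProbUniformlyOn P (fun m n ω => plugInQ (b m n ω) x) (quantile (κ x))
        (Icc η (1 - η)) ∧
      TendstoInProbUniformlyOn P (fun m n ω => qZ (plugInQ (b m n ω) x)) (qZ (quantile (κ x)))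
        (Icc η (1 - η)) ∧
      TendstoInMeasure P
        (fun (mn : ℕ × ℕ) ω => ∫ p in η..(1 - η), qZ (plugInQ (b mn.1 mn.2 ω) x) p)
        (atTop ×ˢ atTop) (fun _ => ∫ p in η..(1 - η), qZ (quantile (κ x)) p)

end

end CondQuantile

/-!
The quantile regression objective is convex in the coefficients. By the law of large numbers its
excess over the value at `0` converges to the population objective, uniformly on compact sets of
levels and coefficients (`ObeysLLN.tendstoUniformlyOn`), and no moment of the response is needed,
because the excess is bounded by a multiple of the covariates. The covariates have finite second
moments and satisfy no linear relation, both of which follow from the convergence of the design to a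
positive definite matrix. By Knight's identity, applied conditionally on the covariates, `β p` is
the only minimiser of the population objective (`LogLinearQuantileModel.eq_of_integral_le`). By
compactness the minimum is separated uniformly in `p ∈ [η, 1 - η]`, and by convexity every empirical
minimiser is then close to `β p`, uniformly in `p` (`ObeysLLN.eventually_norm_sub_le`). As the event
involved does not depend on the grid, nothing relates `m` and `n`.

The isotonic regression of the grid values depends also on the values near the ends of the grid, on
which there is no uniform control. Its value at `j` is at most the mean of the data over some
interval `[a, j]` and at least the mean over some interval `[j, c]`, so it suffices that the
estimates near the ends are small on average
(`ObeysLLN.eventually_sum_norm_left_le`). This is where integrability of the response enters. The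
minimal value `V(p)` of the empirical objective is a concave function of `p` with the mean residual
at the minimiser as a supergradient; hence the mean residuals at the levels `1/m, …, K/m` sum to at
most `m V(K/m)`. The negative parts of the residuals are bounded by `2 V(p)` for `p ≤ 1/2`, and
`V(p)` is small for small `p`. So the mean absolute residuals, and by nondegeneracy of the design
the norms of the estimates, are small on average. The right end is obtained by reflecting the
response.

The statements on quantile functions, inequality curves and integrals follow by continuity. Here
convergence in probability is expressed as convergence along a filter, `highProb`, and the
deterministic part of the argument works with any filter of samples along which empirical means
converge (`ObeysLLN`).
-/

namespace CondQuantile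

variable {d : ℕ}

/-! ### Empirical means and filters obeying the law of large numbers -/

/-- An observation `(x, z)`: covariates and response. -/
abbrev Obs (d : ℕ) := (Fin d → ℝ) × ℝ

/-- A sample: its size `n` and a sequence of observations, of which only the first `n` count. -/
abbrev Sample (d : ℕ) := ℕ × (ℕ → Obs d)

/-- The empirical mean of `φ` over a sample. -/
noncomputable def emean (φ : Obs d → ℝ) (s : Sample d) : ℝ :=
  (s.1 : ℝ)⁻¹ * ∑ k ∈ Finset.range s.1, φ (s.2 k)

lemma emean_add (φ ψ : Obs d → ℝ) (s : Sample d) :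
    emean (fun w => φ w + ψ w) s = emean φ s + emean ψ s := by
  simp [emean, Finset.sum_add_distrib, mul_add]

lemma emean_sub (φ ψ : Obs d → ℝ) (s : Sample d) :
    emean (fun w => φ w - ψ w) s = emean φ s - emean ψ s := by
  simp [emean, Finset.sum_sub_distrib, mul_sub]

lemma emean_const_mul (c : ℝ) (φ : Obs d → ℝ) (s : Sample d) :
    emean (fun w => c * φ w) s = c * emean φ s := by
  simp only [emean, ← Finset.mul_sum]; ring

lemma emean_mono {φ ψ : Obs d → ℝ} (h : ∀ w, φ w ≤ ψ w) (s : Sample d) :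
    emean φ s ≤ emean ψ s :=
  mul_le_mul_of_nonneg_left (Finset.sum_le_sum fun _ _ => h _) (by positivity)

lemma emean_nonneg {φ : Obs d → ℝ} (h : ∀ w, 0 ≤ φ w) (s : Sample d) : 0 ≤ emean φ s :=
  mul_nonneg (by positivity) (Finset.sum_nonneg fun _ _ => h _)

lemma emean_const_le {c : ℝ} (hc : 0 ≤ c) (s : Sample d) : emean (fun _ => c) s ≤ c := by
  rcases Nat.eq_zero_or_pos s.1 with h | h
  · simp [emean, h, hc]
  · have : (s.1 : ℝ) ≠ 0 := by positivity
    simp [emean, this]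

lemma abs_emean_sub_le {φ ψ g : Obs d → ℝ} (h : ∀ w, |φ w - ψ w| ≤ g w) (s : Sample d) :
    |emean φ s - emean ψ s| ≤ emean g s := by
  rw [← emean_sub, abs_le]
  constructor
  · have h1 := emean_mono (φ := fun w => (-1) * g w) (ψ := fun w => φ w - ψ w)
      (fun w => by linarith [(abs_le.1 (h w)).1]) s
    rw [emean_const_mul] at h1
    linarith
  · exact emean_mono (fun w => (abs_le.1 (h w)).2) s

/-- The law of large numbers along a filter of samples: the empirical mean of every integrable
function tends to its mean under `μ`. -/
def ObeysLLN (μ : Measure (Obs d)) (l : Filter (Sample d)) : Prop :=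
  ∀ φ : Obs d → ℝ, Measurable φ → Integrable φ μ → Tendsto (emean φ) l (𝓝 (∫ w, φ w ∂μ))

lemma abs_integral_sub_le {μ : Measure (Obs d)} {φ ψ g : Obs d → ℝ} (hφ : Integrable φ μ)
    (hψ : Integrable ψ μ) (hg : Integrable g μ) {c : ℝ} (h : ∀ w, |φ w - ψ w| ≤ c * g w) :
    |(∫ w, φ w ∂μ) - ∫ w, ψ w ∂μ| ≤ c * ∫ w, g w ∂μ := by
  rw [← integral_sub hφ hψ, ← integral_const_mul]
  exact (abs_integral_le_integral_abs).trans
    (integral_mono (hφ.sub hψ).abs (hg.const_mul c) h)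

/-- A uniform law of large numbers over a compact parameter set, for families that are Lipschitz
in the parameter with an integrable Lipschitz constant. -/
theorem ObeysLLN.tendstoUniformlyOn {μ : Measure (Obs d)} {l : Filter (Sample d)}
    (hl : ObeysLLN μ l) {Θ : Type*} [PseudoMetricSpace Θ] {K : Set Θ} (hK : IsCompact K)
    {φ : Θ → Obs d → ℝ} {g : Obs d → ℝ} (hφm : ∀ θ ∈ K, Measurable (φ θ))
    (hφ : ∀ θ ∈ K, Integrable (φ θ) μ) (hgm : Measurable g) (hg : Integrable g μ)
    (hg0 : ∀ w, 0 ≤ g w)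
    (hLip : ∀ θ ∈ K, ∀ θ' ∈ K, ∀ w, |φ θ w - φ θ' w| ≤ dist θ θ' * g w) :
    TendstoUniformlyOn (fun s θ => emean (φ θ) s) (fun θ => ∫ w, φ θ w ∂μ) l K := by
  rw [Metric.tendstoUniformlyOn_iff]
  intro ε hε
  set G := ∫ w, g w ∂μ with hG
  have hG0 : 0 ≤ G := integral_nonneg hg0
  have hδ : 0 < ε / (3 * (G + 1)) := by positivity
  set δ := ε / (3 * (G + 1)) with hδd
  have hδG : δ * (G + 1) = ε / 3 := by rw [hδd]; field_simp
  obtain ⟨t, htK, htf, hcov⟩ := hK.finite_cover_balls hδ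
  have h1 : ∀ᶠ s in l, ∀ θ ∈ t, dist (emean (φ θ) s) (∫ w, φ θ w ∂μ) < ε / 3 :=
    (eventually_all_finite htf).2 fun θ hθ =>
      (Metric.tendsto_nhds.1 (hl _ (hφm θ (htK hθ)) (hφ θ (htK hθ)))) _ (by positivity)
  have h2 : ∀ᶠ s in l, emean g s < G + 1 :=
    (hl g hgm hg).eventually_lt_const (by linarith)
  filter_upwards [h1, h2] with s hs1 hs2 θ hθ
  obtain ⟨θ', hθ', hd⟩ := mem_iUnion₂.1 (hcov hθ)
  have hd' : dist θ θ' ≤ δ := (Metric.mem_ball.1 hd).le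
  have a1 := abs_integral_sub_le (hφ θ hθ) (hφ θ' (htK hθ')) hg (hLip θ hθ θ' (htK hθ'))
  have a2 := abs_emean_sub_le (hLip θ hθ θ' (htK hθ')) s
  rw [emean_const_mul] at a2
  have a3 := hs1 θ' hθ'
  rw [Real.dist_eq] at a3 ⊢
  have b1 : dist θ θ' * G ≤ δ * (G + 1) :=
    mul_le_mul hd' (by linarith) hG0 hδ.le
  have b2 : dist θ θ' * emean g s ≤ δ * (G + 1) :=
    mul_le_mul hd' hs2.le (emean_nonneg hg0 s) hδ.le
  rw [abs_lt] at a3 ⊢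
  rw [abs_le] at a1 a2
  constructor <;> linarith [a1.1, a1.2, a2.1, a2.2, a3.1, a3.2]

/-! ### The linear predictor and the quantile regression loss -/

lemma linPred_add (b c : Fin (d + 1) → ℝ) (x : Fin d → ℝ) :
    linPred (b + c) x = linPred b x + linPred c x := by
  simp only [linPred, Pi.add_apply, add_mul, Finset.sum_add_distrib]; ring

lemma linPred_smul (t : ℝ) (b : Fin (d + 1) → ℝ) (x : Fin d → ℝ) :
    linPred (t • b) x = t * linPred b x := by
  simp only [linPred, Pi.smul_apply, smul_eq_mul, mul_add, Finset.mul_sum, mul_assoc]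

lemma linPred_neg (b : Fin (d + 1) → ℝ) (x : Fin d → ℝ) : linPred (-b) x = -linPred b x := by
  simpa using linPred_smul (-1) b x

lemma linPred_sub (b c : Fin (d + 1) → ℝ) (x : Fin d → ℝ) :
    linPred (b - c) x = linPred b x - linPred c x := by
  rw [sub_eq_add_neg, linPred_add, linPred_neg, ← sub_eq_add_neg]

lemma linPred_single_zero (t : ℝ) (x : Fin d → ℝ) :
    linPred (Pi.single (0 : Fin (d + 1)) t) x = t := by
  simp [linPred, Fin.succ_ne_zero]

/-- The weight `1 + |x₁| + ⋯ + |x_d|`, the Lipschitz constant of `b ↦ linPred b x`. -/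
def weight (x : Fin d → ℝ) : ℝ := 1 + ∑ i, |x i|

lemma weight_nonneg (x : Fin d → ℝ) : 0 ≤ weight x := by
  unfold weight; positivity

lemma abs_linPred_le (b : Fin (d + 1) → ℝ) (x : Fin d → ℝ) :
    |linPred b x| ≤ ‖b‖ * weight x := by
  have hb : ∀ i, |b i| ≤ ‖b‖ := fun i => norm_le_pi_norm b i
  calc |linPred b x| ≤ |b 0| + |∑ i : Fin d, b i.succ * x i| := abs_add_le _ _
    _ ≤ |b 0| + ∑ i : Fin d, |b i.succ * x i| := by
        gcongr; exact Finset.abs_sum_le_sum_abs _ _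
    _ ≤ ‖b‖ + ∑ i : Fin d, ‖b‖ * |x i| := by
        gcongr with i
        · exact hb 0
        · rw [abs_mul]; gcongr; exact hb _
    _ = ‖b‖ * weight x := by rw [weight, ← Finset.mul_sum]; ring

lemma measurable_linPred (b : Fin (d + 1) → ℝ) :
    Measurable fun x : Fin d → ℝ => linPred b x := by
  unfold linPred; fun_prop

lemma measurable_weight : Measurable (weight : (Fin d → ℝ) → ℝ) := by
  unfold weight; fun_prop

lemma rho_eq (p u : ℝ) : rho p u = p * u + max (-u) 0 := by
  unfold rho
  split_ifs with h
  · rw [max_eq_left (by linarith)]; ring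
  · rw [max_eq_right (by linarith)]; ring

lemma rho_nonneg {p : ℝ} (h0 : 0 ≤ p) (h1 : p ≤ 1) (u : ℝ) : 0 ≤ rho p u := by
  rw [rho_eq]
  rcases le_total 0 u with h | h
  · rw [max_eq_right (by linarith)]; nlinarith
  · rw [max_eq_left (by linarith)]; nlinarith

/-- `ρ_p` is `1`-Lipschitz for `p ∈ [0, 1]`. -/
lemma abs_rho_sub_le {p : ℝ} (h0 : 0 ≤ p) (h1 : p ≤ 1) (u v : ℝ) :
    |rho p u - rho p v| ≤ |u - v| := by
  rw [rho_eq, rho_eq]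
  rcases le_total u v with h | h <;> rcases max_cases (-u) 0 with hu | hu <;>
    rcases max_cases (-v) 0 with hv | hv <;> rw [hu.1, hv.1] <;>
    first
    | rw [abs_of_nonpos (by linarith : u - v ≤ 0), abs_le]; constructor <;> nlinarith
    | rw [abs_of_nonneg (by linarith : 0 ≤ u - v), abs_le]; constructor <;> nlinarith

lemma measurable_rho (p : ℝ) : Measurable (rho p) := by
  have : rho p = fun u => p * u + max (-u) 0 := funext (rho_eq p)
  rw [this]; fun_prop

/-- The residual `z - b ⬝ (1, x)` of an observation. -/
def residual (b : Fin (d + 1) → ℝ) (w : Obs d) : ℝ := w.2 - linPred b w.1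

lemma measurable_residual (b : Fin (d + 1) → ℝ) : Measurable (residual (d := d) b) :=
  measurable_snd.sub ((measurable_linPred b).comp measurable_fst)

/-- `b` is a quantile regression coefficient of the sample `s` at the level `p`. -/
def IsMinimiser (s : Sample d) (p : ℝ) (b : Fin (d + 1) → ℝ) : Prop :=
  IsOQRCoef s.1 (fun k => (s.2 k).1) (fun k => (s.2 k).2) p b

lemma IsMinimiser.emean_le {s : Sample d} {p : ℝ} {b : Fin (d + 1) → ℝ} (h : IsMinimiser s p b)
    (b' : Fin (d + 1) → ℝ) :
    emean (fun w => rho p (residual b w)) s ≤ emean (fun w => rho p (residual b' w)) s :=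
  mul_le_mul_of_nonneg_left (h b') (by positivity)

/-- Convexity of the quantile regression objective along a segment. -/
lemma rho_convex {p t : ℝ} (h0 : 0 ≤ t) (h1 : t ≤ 1) (u v : ℝ) :
    rho p ((1 - t) * u + t * v) ≤ (1 - t) * rho p u + t * rho p v := by
  simp only [rho_eq]
  have : max (-((1 - t) * u + t * v)) 0 ≤ (1 - t) * max (-u) 0 + t * max (-v) 0 := by
    have h1' : 0 ≤ 1 - t := by linarith
    apply max_le
    · nlinarith [mul_le_mul_of_nonneg_left (le_max_left (-u) 0) h1',
        mul_le_mul_of_nonneg_left (le_max_left (-v) 0) h0]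
    · have := le_max_right (-u) 0; have := le_max_right (-v) 0; positivity
  linarith

/-! ### Consistency of the minimisers on compact sets of levels -/

/-- The loss of `b` at the level `p`, relative to the loss of `0`. Unlike the loss itself it is
integrable as soon as the covariates are. -/
noncomputable def excessLoss (θ : ℝ × (Fin (d + 1) → ℝ)) (w : Obs d) : ℝ :=
  rho θ.1 (residual θ.2 w) - rho θ.1 w.2

lemma measurable_excessLoss (θ : ℝ × (Fin (d + 1) → ℝ)) : Measurable (excessLoss (d := d) θ) :=
  ((measurable_rho _).comp (measurable_residual _)).sub ((measurable_rho _).comp measurable_snd)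

lemma abs_excessLoss_le {θ : ℝ × (Fin (d + 1) → ℝ)} (h0 : 0 ≤ θ.1) (h1 : θ.1 ≤ 1) (w : Obs d) :
    |excessLoss θ w| ≤ ‖θ.2‖ * weight w.1 := by
  refine (abs_rho_sub_le h0 h1 _ _).trans ?_
  have : residual θ.2 w - w.2 = -linPred θ.2 w.1 := by unfold residual; ring
  rw [this, abs_neg]
  exact abs_linPred_le _ _

lemma integrable_excessLoss {μ : Measure (Obs d)} (hw : Integrable (fun w => weight w.1) μ)
    {θ : ℝ × (Fin (d + 1) → ℝ)} (h0 : 0 ≤ θ.1) (h1 : θ.1 ≤ 1) :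
    Integrable (excessLoss (d := d) θ) μ :=
  (hw.const_mul ‖θ.2‖).mono' (measurable_excessLoss θ).aestronglyMeasurable
    (Eventually.of_forall fun w => abs_excessLoss_le h0 h1 w)

lemma abs_excessLoss_sub_le {R : ℝ} {θ θ' : ℝ × (Fin (d + 1) → ℝ)}
    (hθ : θ ∈ Icc (0 : ℝ) 1 ×ˢ Metric.closedBall (0 : Fin (d + 1) → ℝ) R)
    (hθ' : θ' ∈ Icc (0 : ℝ) 1 ×ˢ Metric.closedBall (0 : Fin (d + 1) → ℝ) R) (w : Obs d) :
    |excessLoss θ w - excessLoss θ' w| ≤ dist θ θ' * ((1 + R) * weight w.1) := by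
  obtain ⟨p, b⟩ := θ
  obtain ⟨q, c⟩ := θ'
  have hc : ‖c‖ ≤ R := by simpa using hθ'.2
  have hpq : |p - q| ≤ dist (p, b) (q, c) := le_max_left _ _
  have hbc : ‖b - c‖ ≤ dist (p, b) (q, c) := by rw [← dist_eq_norm]; exact le_max_right _ _
  have e : excessLoss (p, b) w - excessLoss (q, c) w =
      (rho p (residual b w) - rho p (residual c w)) + (p - q) * -linPred c w.1 := by
    simp only [excessLoss, rho_eq, residual]; ring
  have h1 := abs_rho_sub_le hθ.1.1 hθ.1.2 (residual b w) (residual c w)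
  have h2 : residual b w - residual c w = -linPred (b - c) w.1 := by
    rw [linPred_sub]; unfold residual; ring
  rw [h2, abs_neg] at h1
  have hw0 := weight_nonneg w.1
  calc |excessLoss (p, b) w - excessLoss (q, c) w|
      ≤ |rho p (residual b w) - rho p (residual c w)| + |(p - q) * -linPred c w.1| := by
        rw [e]; exact abs_add_le _ _
    _ ≤ ‖b - c‖ * weight w.1 + |p - q| * (‖c‖ * weight w.1) := by
        rw [abs_mul, abs_neg]
        gcongr
        · exact h1.trans (abs_linPred_le _ _)
        · exact abs_linPred_le _ _
    _ ≤ dist (p, b) (q, c) * weight w.1 + dist (p, b) (q, c) * (R * weight w.1) := by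
        gcongr
    _ = _ := by ring

/-- What is needed of the joint law `μ` of covariates and response, and of the coefficient curve
`β`, for the consistency of quantile regression. -/
structure IsQuantilePopulation (μ : Measure (Obs d)) (β : ℝ → Fin (d + 1) → ℝ) : Prop where
  integrable_weight : Integrable (fun w => weight w.1) μ
  nondegenerate : ∀ v : Fin (d + 1) → ℝ, (∀ᵐ w ∂μ, linPred v w.1 = 0) → v = 0
  unique_minimiser : ∀ p ∈ Ioo (0 : ℝ) 1, ∀ b : Fin (d + 1) → ℝ,
    ∫ w, excessLoss (p, b) w ∂μ ≤ ∫ w, excessLoss (p, β p) w ∂μ → b = β p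
  continuousOn : ∀ η ∈ Ioo (0 : ℝ) (1 / 2), ContinuousOn β (Icc η (1 - η))

/-- The population objective is continuous, jointly in the level and the coefficients. -/
lemma continuousOn_integral_excessLoss {μ : Measure (Obs d)}
    (hw : Integrable (fun w => weight w.1) μ) (R : ℝ) :
    ContinuousOn (fun θ : ℝ × (Fin (d + 1) → ℝ) => ∫ w, excessLoss θ w ∂μ)
      (Icc (0 : ℝ) 1 ×ˢ Metric.closedBall (0 : Fin (d + 1) → ℝ) R) := by
  set G := ∫ w, (1 + R) * weight w.1 ∂μ
  refine (LipschitzOnWith.of_dist_le_mul (K := G.toNNReal) fun θ hθ θ' hθ' => ?_).continuousOn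
  have h := abs_integral_sub_le (integrable_excessLoss hw hθ.1.1 hθ.1.2)
    (integrable_excessLoss hw hθ'.1.1 hθ'.1.2) (hw.const_mul (1 + R))
    (abs_excessLoss_sub_le hθ hθ')
  rw [Real.dist_eq]
  refine h.trans ?_
  rw [mul_comm]
  exact mul_le_mul_of_nonneg_right (Real.le_coe_toNNReal G) dist_nonneg

/-- By compactness the population objective on the sphere of radius `ε` around `β p` exceeds its
minimum by a margin that does not depend on the level `p ∈ [η, 1 - η]`. -/
lemma IsQuantilePopulation.exists_gap {μ : Measure (Obs d)} {β : ℝ → Fin (d + 1) → ℝ}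
    (hμ : IsQuantilePopulation μ β) {η : ℝ} (hη : η ∈ Ioo (0 : ℝ) (1 / 2)) {ε : ℝ} (hε : 0 < ε) :
    ∃ δ > 0, ∀ p ∈ Icc η (1 - η), ∀ v : Fin (d + 1) → ℝ, ‖v‖ = ε →
      δ ≤ ∫ w, excessLoss (p, β p + v) w ∂μ - ∫ w, excessLoss (p, β p) w ∂μ := by
  have hβ := hμ.continuousOn η hη
  obtain ⟨B, hB⟩ := (isCompact_Icc.image_of_continuousOn hβ).isBounded.exists_norm_le
  have hK : IsCompact (Icc η (1 - η) ×ˢ Metric.sphere (0 : Fin (d + 1) → ℝ) ε) :=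
    isCompact_Icc.prod (isCompact_sphere _ _)
  have h01 : ∀ p ∈ Icc η (1 - η), p ∈ Icc (0 : ℝ) 1 := fun p hp =>
    ⟨hη.1.le.trans hp.1, hp.2.trans (by linarith [hη.1])⟩
  have hI := continuousOn_integral_excessLoss hμ.integrable_weight (B + ε)
  have hβ1 : ContinuousOn (fun θ : ℝ × (Fin (d + 1) → ℝ) => β θ.1)
      (Icc η (1 - η) ×ˢ Metric.sphere (0 : Fin (d + 1) → ℝ) ε) :=
    hβ.comp continuousOn_fst fun θ hθ => hθ.1
  have hc : ContinuousOn (fun θ : ℝ × (Fin (d + 1) → ℝ) =>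
      ∫ w, excessLoss (θ.1, β θ.1 + θ.2) w ∂μ - ∫ w, excessLoss (θ.1, β θ.1) w ∂μ)
      (Icc η (1 - η) ×ˢ Metric.sphere (0 : Fin (d + 1) → ℝ) ε) := by
    refine ContinuousOn.sub ?_ ?_
    · refine hI.comp (continuousOn_fst.prodMk (hβ1.add continuousOn_snd)) fun θ hθ => ?_
      refine ⟨h01 _ hθ.1, ?_⟩
      rw [mem_closedBall_zero_iff]
      exact (norm_add_le _ _).trans
        (add_le_add (hB _ (mem_image_of_mem _ hθ.1)) (mem_sphere_zero_iff_norm.1 hθ.2).le)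
    · refine hI.comp (continuousOn_fst.prodMk hβ1) fun θ hθ => ?_
      refine ⟨h01 _ hθ.1, ?_⟩
      rw [mem_closedBall_zero_iff]
      exact (hB _ (mem_image_of_mem _ hθ.1)).trans (by linarith)
  obtain ⟨δ, hδ, h⟩ := hK.exists_forall_le' hc (a := 0) fun θ hθ => by
    have hp : θ.1 ∈ Ioo (0 : ℝ) 1 :=
      ⟨hη.1.trans_le hθ.1.1, hθ.1.2.trans_lt (by linarith [hη.1])⟩
    by_contra! hle
    have := hμ.unique_minimiser θ.1 hp _ (sub_nonpos.1 hle)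
    have hv : θ.2 = 0 := by simpa using this
    have := mem_sphere_zero_iff_norm.1 hθ.2
    rw [hv, norm_zero] at this
    linarith
  exact ⟨δ, hδ, fun p hp v hv => h (p, v) ⟨hp, by simpa using hv⟩⟩

/-- Consistency of quantile regression, uniformly over the levels in `[η, 1 - η]` and over the
choice of the minimisers: a minimiser farther than `ε` from `β p` would, by convexity, put a point
of the sphere of radius `ε` around `β p` below the value of the objective at `β p`. -/
theorem ObeysLLN.eventually_norm_sub_le {μ : Measure (Obs d)} {l : Filter (Sample d)}
    (hl : ObeysLLN μ l) {β : ℝ → Fin (d + 1) → ℝ} (hμ : IsQuantilePopulation μ β) {η : ℝ}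
    (hη : η ∈ Ioo (0 : ℝ) (1 / 2)) {ε : ℝ} (hε : 0 < ε) :
    ∀ᶠ s in l, ∀ p ∈ Icc η (1 - η), ∀ b, IsMinimiser s p b → ‖b - β p‖ ≤ ε := by
  obtain ⟨δ, hδ, hgap⟩ := hμ.exists_gap hη hε
  obtain ⟨B, hB⟩ :=
    (isCompact_Icc.image_of_continuousOn (hμ.continuousOn η hη)).isBounded.exists_norm_le
  have hR : 0 ≤ B + ε := by
    have := (norm_nonneg _).trans (hB _ (mem_image_of_mem β
      (⟨le_rfl, by linarith [hη.2]⟩ : η ∈ Icc η (1 - η))))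
    linarith
  have hK : IsCompact (Icc (0 : ℝ) 1 ×ˢ Metric.closedBall (0 : Fin (d + 1) → ℝ) (B + ε)) :=
    isCompact_Icc.prod (isCompact_closedBall _ _)
  have hU := hl.tendstoUniformlyOn hK (φ := excessLoss) (g := fun w => (1 + (B + ε)) * weight w.1)
    (fun θ _ => measurable_excessLoss θ)
    (fun θ hθ => integrable_excessLoss hμ.integrable_weight hθ.1.1 hθ.1.2)
    ((measurable_weight.comp measurable_fst).const_mul _)
    (hμ.integrable_weight.const_mul _)
    (fun w => mul_nonneg (by linarith) (weight_nonneg _))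
    (fun θ hθ θ' hθ' w => abs_excessLoss_sub_le hθ hθ' w)
  rw [Metric.tendstoUniformlyOn_iff] at hU
  filter_upwards [hU (δ / 3) (by positivity)] with s hs p hp b hb
  by_contra! hlt
  set r := ‖b - β p‖ with hr
  have hr0 : 0 < r := hε.trans hlt
  set t := ε / r with ht
  have ht0 : 0 ≤ t := by positivity
  have ht1 : t ≤ 1 := (div_le_one hr0).2 hlt.le
  have hp01 : p ∈ Icc (0 : ℝ) 1 := ⟨hη.1.le.trans hp.1, hp.2.trans (by linarith [hη.1])⟩
  set v := t • (b - β p) with hv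
  have hvn : ‖v‖ = ε := by
    rw [hv, norm_smul, Real.norm_of_nonneg ht0, ← hr, ht]; field_simp
  have hβp : ‖β p‖ ≤ B := hB _ (mem_image_of_mem β hp)
  have h1 := hs (p, β p + v) ⟨hp01, by
    rw [mem_closedBall_zero_iff]
    exact (norm_add_le _ _).trans (by rw [hvn]; linarith)⟩
  have h2 := hs (p, β p) ⟨hp01, by rw [mem_closedBall_zero_iff]; linarith⟩
  have hres : ∀ w : Obs d, residual (β p + v) w =
      (1 - t) * residual (β p) w + t * residual b w := fun w => by
    simp only [residual, hv, linPred_add, linPred_smul, linPred_sub]; ring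
  have hconv : emean (fun w => rho p (residual (β p + v) w)) s ≤
      emean (fun w => rho p (residual (β p) w)) s := by
    calc emean (fun w => rho p (residual (β p + v) w)) s
        ≤ emean (fun w => (1 - t) * rho p (residual (β p) w) + t * rho p (residual b w)) s :=
          emean_mono (fun w => by rw [hres]; exact rho_convex ht0 ht1 _ _) s
      _ = (1 - t) * emean (fun w => rho p (residual (β p) w)) s +
            t * emean (fun w => rho p (residual b w)) s := by
          rw [emean_add, emean_const_mul, emean_const_mul]
      _ ≤ (1 - t) * emean (fun w => rho p (residual (β p) w)) s +
            t * emean (fun w => rho p (residual (β p) w)) s := by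
          gcongr; exact hb.emean_le _
      _ = _ := by ring
  have e1 : emean (excessLoss (p, β p + v)) s =
      emean (fun w => rho p (residual (β p + v) w)) s - emean (fun w => rho p w.2) s :=
    emean_sub _ _ s
  have e2 : emean (excessLoss (p, β p)) s =
      emean (fun w => rho p (residual (β p) w)) s - emean (fun w => rho p w.2) s :=
    emean_sub _ _ s
  have hg := hgap p hp v hvn
  rw [Real.dist_eq, abs_lt] at h1 h2
  linarith [h1.1, h1.2, h2.1, h2.2]

/-- In a nondegenerate population the mean absolute linear predictor is coercive, and so is,
eventually, its empirical version. -/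
theorem ObeysLLN.eventually_coercive {μ : Measure (Obs d)} {l : Filter (Sample d)}
    (hl : ObeysLLN μ l) {β : ℝ → Fin (d + 1) → ℝ} (hμ : IsQuantilePopulation μ β) :
    ∃ c > 0, ∀ᶠ s in l, ∀ b : Fin (d + 1) → ℝ,
      c * ‖b‖ ≤ emean (fun w => |linPred b w.1|) s := by
  have hwt := hμ.integrable_weight
  have hK : IsCompact (Metric.sphere (0 : Fin (d + 1) → ℝ) 1) := isCompact_sphere _ _
  have hm : ∀ b : Fin (d + 1) → ℝ, Measurable fun w : Obs d => |linPred b w.1| := fun b =>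
    ((measurable_linPred b).comp measurable_fst).abs
  have hi : ∀ b : Fin (d + 1) → ℝ, Integrable (fun w : Obs d => |linPred b w.1|) μ := fun b =>
    (hwt.const_mul ‖b‖).mono' (hm b).aestronglyMeasurable
      (Eventually.of_forall fun w => by
        rw [Real.norm_eq_abs, abs_abs]; exact abs_linPred_le b w.1)
  have hLip : ∀ b b' : Fin (d + 1) → ℝ, ∀ w : Obs d,
      |(|linPred b w.1|) - (|linPred b' w.1|)| ≤ dist b b' * weight w.1 := fun b b' w => by
    refine (abs_abs_sub_abs_le _ _).trans ?_
    rw [← linPred_sub, dist_eq_norm]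
    exact abs_linPred_le _ _
  have hcont : ContinuousOn (fun b : Fin (d + 1) → ℝ => ∫ w, |linPred b w.1| ∂μ)
      (Metric.sphere (0 : Fin (d + 1) → ℝ) 1) := by
    refine (LipschitzOnWith.of_dist_le_mul (K := (∫ w, weight w.1 ∂μ).toNNReal)
      fun b _ b' _ => ?_).continuousOn
    rw [Real.dist_eq]
    refine (abs_integral_sub_le (hi b) (hi b') hwt (hLip b b')).trans ?_
    rw [mul_comm]
    exact mul_le_mul_of_nonneg_right (Real.le_coe_toNNReal _) dist_nonneg
  obtain ⟨δ, hδ, h⟩ := hK.exists_forall_le' hcont (a := 0) fun b hb => by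
    by_contra! hle
    have h0 : ∫ w, |linPred b w.1| ∂μ = 0 :=
      le_antisymm hle (integral_nonneg fun _ => abs_nonneg _)
    have hae := (integral_eq_zero_iff_of_nonneg (fun _ => abs_nonneg _) (hi b)).1 h0
    have : b = 0 := hμ.nondegenerate b (hae.mono fun w hw => by simpa using hw)
    rw [mem_sphere_zero_iff_norm, this, norm_zero] at hb
    exact zero_ne_one hb
  refine ⟨δ / 2, by positivity, ?_⟩
  have hU := hl.tendstoUniformlyOn hK (φ := fun b w => |linPred b w.1|)
    (fun b _ => hm b) (fun b _ => hi b) (measurable_weight.comp measurable_fst) hwt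
    (fun w => weight_nonneg _) (fun b _ b' _ w => hLip b b' w)
  filter_upwards [Metric.tendstoUniformlyOn_iff.1 hU (δ / 2) (by positivity)] with s hs b
  rcases eq_or_ne b 0 with rfl | hb
  · simpa using emean_nonneg (fun w => abs_nonneg _) s
  have hn : 0 < ‖b‖ := norm_pos_iff.2 hb
  have hu : ‖b‖⁻¹ • b ∈ Metric.sphere (0 : Fin (d + 1) → ℝ) 1 := by
    rw [mem_sphere_zero_iff_norm, norm_smul, norm_inv, norm_norm, inv_mul_cancel₀ hn.ne']
  have h1 := hs _ hu
  have h2 := h _ hu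
  rw [Real.dist_eq, abs_lt] at h1
  have e : emean (fun w => |linPred b w.1|) s =
      ‖b‖ * emean (fun w => |linPred (‖b‖⁻¹ • b) w.1|) s := by
    rw [← emean_const_mul]
    congr 1
    funext w
    rw [linPred_smul, abs_mul, abs_of_pos (inv_pos.2 hn), mul_inv_cancel_left₀ hn.ne']
  rw [e, mul_comm]
  exact mul_le_mul_of_nonneg_left (by linarith [h1.2]) hn.le

/-! ### The estimates at extreme levels -/

/-- For small levels the empirical objective is uniformly small at its minimisers, as one sees by
comparing with a constant predictor `-T` far to the left. -/
lemma ObeysLLN.eventually_objective_le {μ : Measure (Obs d)} {l : Filter (Sample d)}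
    (hl : ObeysLLN μ l) (hz : Integrable (fun w : Obs d => w.2) μ) {ε : ℝ} (hε : 0 < ε) :
    ∃ η > 0, ∀ᶠ s in l, ∀ p, 0 ≤ p → p ≤ η → ∀ b, IsMinimiser s p b →
      emean (fun w => rho p (residual b w)) s ≤ ε := by
  set φ : ℕ → Obs d → ℝ := fun T w => max (-(w.2 + T)) 0 with hφ
  have hφm : ∀ T, Measurable (φ T) := fun T => by simp only [hφ]; fun_prop
  have hφb : ∀ T w, ‖φ T w‖ ≤ |w.2| := fun T w => by
    have hT : (0 : ℝ) ≤ T := T.cast_nonneg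
    rw [Real.norm_of_nonneg (le_max_right _ _)]
    exact max_le (by linarith [neg_abs_le w.2]) (abs_nonneg _)
  have hlim : Tendsto (fun T => ∫ w, φ T w ∂μ) atTop (𝓝 (∫ _, (0 : ℝ) ∂μ)) := by
    refine tendsto_integral_of_dominated_convergence (fun w => |w.2|)
      (fun T => (hφm T).aestronglyMeasurable) hz.abs
      (fun T => Eventually.of_forall (hφb T)) (Eventually.of_forall fun w => ?_)
    refine tendsto_const_nhds.congr' ?_
    filter_upwards [eventually_ge_atTop ⌈-w.2⌉₊] with T hT
    have : -w.2 ≤ T := (Nat.le_ceil _).trans (by exact_mod_cast hT)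
    exact (max_eq_right (by linarith)).symm
  rw [integral_zero] at hlim
  obtain ⟨T, hT⟩ := (hlim.eventually_lt_const (by positivity : 0 < ε / 2)).exists
  set G := ∫ w : Obs d, |w.2| ∂μ with hG
  have hG0 : 0 ≤ G := integral_nonneg fun _ => abs_nonneg _
  have hT0 : (0 : ℝ) ≤ T := T.cast_nonneg
  refine ⟨ε / (2 * (T + (G + 1))), by positivity, ?_⟩
  have hφi : Integrable (φ T) μ :=
    hz.abs.mono' (hφm T).aestronglyMeasurable (Eventually.of_forall (hφb T))
  filter_upwards [(hl _ (hφm T) hφi).eventually_lt_const hT,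
    (hl _ measurable_snd.abs hz.abs).eventually_lt_const (by linarith : G < G + 1)]
    with s hs1 hs2 p hp0 hp b hb
  calc emean (fun w => rho p (residual b w)) s
      ≤ emean (fun w => rho p (residual (Pi.single 0 (-T : ℝ)) w)) s := hb.emean_le _
    _ ≤ emean (fun w => (p * T + p * |w.2|) + φ T w) s := by
        refine emean_mono (fun w => ?_) s
        rw [rho_eq, residual, linPred_single_zero, sub_neg_eq_add]
        have := mul_le_mul_of_nonneg_left (le_abs_self w.2) hp0
        simp only [hφ]
        linarith
    _ = emean (fun _ => p * T) s + p * emean (fun w => |w.2|) s + emean (φ T) s := by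
        rw [emean_add, emean_add, emean_const_mul p (fun w => |w.2|)]
    _ ≤ p * T + p * (G + 1) + emean (φ T) s := by
        gcongr
        exact emean_const_le (by positivity) s
    _ ≤ ε / (2 * (T + (G + 1))) * (T + (G + 1)) + ε / 2 := by
        have := mul_le_mul_of_nonneg_right hp (by positivity : 0 ≤ T + (G + 1))
        linarith
    _ = ε := by field_simp; ring

/-- The minimal value of the empirical objective is concave in the level, with the mean residual
as a supergradient. Summing the mean residuals over the levels `1/m, …, K/m` therefore telescopes,
and together with the smallness of the objective this controls the mean absolute fitted values. -/
lemma sum_emean_abs_linPred_le {s : Sample d} {m K : ℕ} (hm : 0 < m) (hK : 2 * K ≤ m)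
    {B : ℕ → Fin (d + 1) → ℝ}
    (hB : ∀ j ∈ Finset.Icc 1 K, IsMinimiser s ((j : ℝ) / m) (B j)) {e : ℝ} (he0 : 0 ≤ e)
    (he : ∀ j ∈ Finset.Icc 1 K, emean (fun w => rho ((j : ℝ) / m) (residual (B j) w)) s ≤ e) :
    ∑ j ∈ Finset.Icc 1 K, emean (fun w => |linPred (B j) w.1|) s ≤
      m * e + K * (4 * e + emean (fun w => |w.2|) s) := by
  have hm' : (0 : ℝ) < m := by exact_mod_cast hm
  set V : ℕ → ℝ := fun j =>
    if j = 0 then 0 else emean (fun w => rho ((j : ℝ) / m) (residual (B j) w)) s with hV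
  have key : ∀ k ≤ K, ∑ j ∈ Finset.Icc 1 k, emean (fun w => |linPred (B j) w.1|) s ≤
      m * V k + k * (4 * e + emean (fun w => |w.2|) s) := by
    intro k
    induction k with
    | zero => intro _; simp [hV]
    | succ k ih =>
      intro hk
      rw [Finset.sum_Icc_succ_top (by omega)]
      have hk1 : k + 1 ∈ Finset.Icc 1 K := Finset.mem_Icc.2 ⟨by omega, hk⟩
      have hp : ((k + 1 : ℕ) : ℝ) / m ≤ 1 / 2 := by
        rw [div_le_div_iff₀ hm' two_pos]
        exact_mod_cast (by omega : (k + 1) * 2 ≤ 1 * m)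
      have hstep : V k ≤ V (k + 1) - (m : ℝ)⁻¹ * emean (residual (B (k + 1))) s := by
        have e1 : emean (fun w => rho ((k : ℝ) / m) (residual (B (k + 1)) w)) s =
            V (k + 1) - (m : ℝ)⁻¹ * emean (residual (B (k + 1))) s := by
          simp only [hV, Nat.succ_ne_zero, if_false]
          rw [← emean_const_mul, ← emean_sub]
          congr 1
          funext w
          simp only [rho_eq]
          push_cast
          field_simp
          ring
        rw [← e1]
        rcases Nat.eq_zero_or_pos k with rfl | hk0
        · simp only [hV, if_true]
          exact emean_nonneg (fun w => rho_nonneg (by positivity) (by simp) _) s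
        · simp only [hV, hk0.ne', if_false]
          exact (hB k (Finset.mem_Icc.2 ⟨hk0, by omega⟩)).emean_le _
      have hstep' : m * V k + emean (residual (B (k + 1))) s ≤ m * V (k + 1) := by
        have := mul_le_mul_of_nonneg_left hstep hm'.le
        rw [mul_sub, mul_inv_cancel_left₀ hm'.ne'] at this
        linarith
      have hterm : emean (fun w => |linPred (B (k + 1)) w.1|) s ≤
          emean (fun w => |w.2|) s + emean (residual (B (k + 1))) s + 4 * e := by
        calc emean (fun w => |linPred (B (k + 1)) w.1|) s
            ≤ emean (fun w => (|w.2| + residual (B (k + 1)) w) +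
                4 * rho (((k + 1 : ℕ) : ℝ) / m) (residual (B (k + 1)) w)) s := by
              refine emean_mono (fun w => ?_) s
              set u := residual (B (k + 1)) w with hu
              have hl : linPred (B (k + 1)) w.1 = w.2 - u := by rw [hu, residual]; ring
              have h1 : |linPred (B (k + 1)) w.1| ≤ |w.2| + |u| := by
                rw [hl]; exact abs_sub _ _
              have hp0 : 0 ≤ ((k + 1 : ℕ) : ℝ) / m := by positivity
              -- `|u| = u + 2 u⁻` and `u⁻ ≤ 2 ρ_p(u)` for `p ≤ 1/2`
              have h2 : |u| ≤ u + 4 * rho (((k + 1 : ℕ) : ℝ) / m) u := by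
                rw [rho_eq]
                rcases le_total 0 u with h | h
                · rw [abs_of_nonneg h, max_eq_right (by linarith)]
                  nlinarith
                · rw [abs_of_nonpos h, max_eq_left (by linarith)]
                  nlinarith
              linarith
          _ = emean (fun w => |w.2|) s + emean (residual (B (k + 1))) s +
                4 * emean (fun w => rho (((k + 1 : ℕ) : ℝ) / m) (residual (B (k + 1)) w)) s := by
              rw [emean_add, emean_add, emean_const_mul]
          _ ≤ _ := by gcongr; exact he _ hk1
      have := ih (by omega)
      push_cast
      linarith
  refine (key K le_rfl).trans ?_
  gcongr
  simp only [hV]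
  split_ifs with h
  · exact he0
  · exact he K (Finset.mem_Icc.2 ⟨by omega, le_rfl⟩)

/-- The sum of the norms of the estimates over the grid points up to `η` is at most `τ m`: with an
integrable response the erratic behaviour of the estimates near the level `0` is negligible on
average. -/
theorem ObeysLLN.eventually_sum_norm_left_le {μ : Measure (Obs d)} {l : Filter (Sample d)}
    (hl : ObeysLLN μ l) (hz : Integrable (fun w : Obs d => w.2) μ) {c : ℝ} (hc0 : 0 < c)
    (hc : ∀ᶠ s in l, ∀ b : Fin (d + 1) → ℝ, c * ‖b‖ ≤ emean (fun w => |linPred b w.1|) s)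
    {τ : ℝ} (hτ : 0 < τ) :
    ∃ η > 0, ∀ᶠ s in l, ∀ (m K : ℕ) (B : ℕ → Fin (d + 1) → ℝ), 0 < m → (K : ℝ) ≤ η * m →
      (∀ j ∈ Finset.Icc 1 K, IsMinimiser s ((j : ℝ) / m) (B j)) →
      ∑ j ∈ Finset.Icc 1 K, ‖B j‖ ≤ τ * m := by
  obtain ⟨η₁, hη₁, h1⟩ := hl.eventually_objective_le hz (by positivity : 0 < c * τ / 6)
  set G := ∫ w : Obs d, |w.2| ∂μ with hG
  have hG0 : 0 ≤ G := integral_nonneg fun _ => abs_nonneg _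
  refine ⟨min η₁ (min (1 / 2) (c * τ / (2 * (G + 1)))), by positivity, ?_⟩
  filter_upwards [h1, hc, (hl _ measurable_snd.abs hz.abs).eventually_lt_const
    (by linarith : G < G + 1)] with s hs1 hs2 hs3 m K B hm hK hB
  have hm' : (0 : ℝ) < m := by exact_mod_cast hm
  have hKa : (K : ℝ) ≤ η₁ * m := hK.trans (by gcongr; exact min_le_left _ _)
  have hKb : (K : ℝ) ≤ 1 / 2 * m :=
    hK.trans (by gcongr; exact (min_le_right _ _).trans (min_le_left _ _))
  have hKc : (K : ℝ) ≤ c * τ / (2 * (G + 1)) * m :=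
    hK.trans (by gcongr; exact (min_le_right _ _).trans (min_le_right _ _))
  have hK2 : 2 * K ≤ m := by
    have : (2 * K : ℝ) ≤ m := by linarith
    exact_mod_cast this
  have hsum := sum_emean_abs_linPred_le hm hK2 hB (by positivity : 0 ≤ c * τ / 6)
    fun j hj => hs1 _ (by positivity) ((div_le_iff₀ hm').2 (le_trans
      (by exact_mod_cast (Finset.mem_Icc.1 hj).2) hKa)) _ (hB j hj)
  have h2 : c * ∑ j ∈ Finset.Icc 1 K, ‖B j‖ ≤ c * (τ * m) := by
    calc c * ∑ j ∈ Finset.Icc 1 K, ‖B j‖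
        ≤ ∑ j ∈ Finset.Icc 1 K, emean (fun w => |linPred (B j) w.1|) s := by
          rw [Finset.mul_sum]; exact Finset.sum_le_sum fun j _ => hs2 _
      _ ≤ m * (c * τ / 6) + K * (4 * (c * τ / 6) + emean (fun w => |w.2|) s) := hsum
      _ ≤ m * (c * τ / 6) + K * (4 * (c * τ / 6) + (G + 1)) := by gcongr
      _ = m * (c * τ / 6) + K * (4 * (c * τ / 6)) + K * (G + 1) := by ring
      _ ≤ m * (c * τ / 6) + 1 / 2 * m * (4 * (c * τ / 6)) +
            c * τ / (2 * (G + 1)) * m * (G + 1) := by gcongr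
      _ = c * (τ * m) := by field_simp; ring
  exact le_of_mul_le_mul_left h2 hc0

/-- The reflection `z ↦ -z` of the response. -/
def reflectObs (w : Obs d) : Obs d := (w.1, -w.2)

/-- The reflection of a sample in the response. -/
def reflectSample (s : Sample d) : Sample d := (s.1, fun k => reflectObs (s.2 k))

lemma measurable_reflectObs : Measurable (reflectObs (d := d)) :=
  measurable_fst.prodMk measurable_snd.neg

lemma ObeysLLN.reflect {μ : Measure (Obs d)} {l : Filter (Sample d)} (hl : ObeysLLN μ l) :
    ObeysLLN (μ.map reflectObs) (l.map reflectSample) := by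
  intro φ hφm hφ
  rw [integral_map measurable_reflectObs.aemeasurable hφm.aestronglyMeasurable, tendsto_map'_iff]
  exact hl _ (hφm.comp measurable_reflectObs)
    ((integrable_map_measure hφm.aestronglyMeasurable measurable_reflectObs.aemeasurable).1 hφ)

/-- Reflection turns quantile regression at the level `p` into that at the level `1 - p`. -/
lemma IsMinimiser.reflect {s : Sample d} {p : ℝ} {b : Fin (d + 1) → ℝ} (h : IsMinimiser s p b) :
    IsMinimiser (reflectSample s) (1 - p) (-b) := by
  have e : ∀ (b : Fin (d + 1) → ℝ) (w : Obs d),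
      rho (1 - p) (-w.2 - linPred b w.1) = rho p (w.2 - linPred (-b) w.1) := fun b w => by
    rw [rho_eq, rho_eq, linPred_neg]
    have : max (-(-w.2 - linPred b w.1)) 0 =
        (w.2 - -linPred b w.1) + max (-(w.2 - -linPred b w.1)) 0 := by
      rcases le_total 0 (w.2 + linPred b w.1) with h | h
      · rw [max_eq_left (by linarith), max_eq_right (by linarith)]; ring
      · rw [max_eq_right (by linarith), max_eq_left (by linarith)]; ring
    rw [this]; ring
  intro b'
  simp only [reflectSample, reflectObs, e, neg_neg]
  exact h (-b')

/-- The estimates near the level `1` are negligible on average as well, by reflection. -/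
theorem ObeysLLN.eventually_sum_norm_right_le {μ : Measure (Obs d)} {l : Filter (Sample d)}
    (hl : ObeysLLN μ l) (hz : Integrable (fun w : Obs d => w.2) μ) {c : ℝ} (hc0 : 0 < c)
    (hc : ∀ᶠ s in l, ∀ b : Fin (d + 1) → ℝ, c * ‖b‖ ≤ emean (fun w => |linPred b w.1|) s)
    {τ : ℝ} (hτ : 0 < τ) :
    ∃ η > 0, ∀ᶠ s in l, ∀ (m K : ℕ) (B : ℕ → Fin (d + 1) → ℝ), 0 < m → (K : ℝ) ≤ η * m →
      (∀ j ∈ Finset.Icc 1 K, IsMinimiser s (1 - (j : ℝ) / m) (B j)) →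
      ∑ j ∈ Finset.Icc 1 K, ‖B j‖ ≤ τ * m := by
  have hz' : Integrable (fun w : Obs d => w.2) (μ.map reflectObs) :=
    (integrable_map_measure measurable_snd.aestronglyMeasurable
      measurable_reflectObs.aemeasurable).2 hz.neg
  obtain ⟨η, hη, h⟩ := hl.reflect.eventually_sum_norm_left_le hz' hc0
    (eventually_map.2 hc) hτ
  refine ⟨η, hη, (eventually_map.1 h).mono fun s hs m K B hm hK hB => ?_⟩
  have := hs m K (fun j => -B j) hm hK fun j hj => by simpa using (hB j hj).reflect
  simpa using this

/-! ### Isotonic regression -/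

/-- The value of the isotonic regression at `j` is at most the mean of the data over some interval
`[a, j]`, namely the part up to `j` of the level block of `j`: otherwise lowering the fit slightly
on this interval, which preserves monotonicity, would improve it. -/
lemma IsIsotonicRegression.exists_sum_nonpos {m : ℕ} {v u : ℕ → ℝ}
    (h : IsIsotonicRegression m v u) {j : ℕ} (hj : j ∈ Ico 1 m) :
    ∃ a, 1 ≤ a ∧ a ≤ j ∧ ∑ k ∈ Finset.Icc a j, (u j - v k) ≤ 0 := by
  classical
  obtain ⟨hmono, hmin⟩ := h
  rw [Finset.coe_Ico] at hmono
  have hex : ∃ a, 1 ≤ a ∧ a ≤ j ∧ u a = u j := ⟨j, hj.1, le_rfl, rfl⟩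
  set a := Nat.find hex with ha
  obtain ⟨ha1, haj, hua⟩ : 1 ≤ a ∧ a ≤ j ∧ u a = u j := Nat.find_spec hex
  have ham : a ∈ Ico 1 m := ⟨ha1, haj.trans_lt hj.2⟩
  have hblock : ∀ k ∈ Finset.Icc a j, u k = u j := fun k hk => by
    obtain ⟨h1, h2⟩ := Finset.mem_Icc.1 hk
    have hkm : k ∈ Ico 1 m := ⟨ha1.trans h1, h2.trans_lt hj.2⟩
    exact le_antisymm (hmono hkm hj h2) (hua ▸ hmono ham hkm h1)
  -- the jump of the fit at the left end of the block
  obtain ⟨gap, hgap, hgap'⟩ : ∃ gap > 0, ∀ x ∈ Ico 1 m, x < a → u x ≤ u a - gap := by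
    by_cases h1 : a = 1
    · exact ⟨1, one_pos, fun x hx hxa => absurd hx.1 (by omega)⟩
    · have hpm : a - 1 ∈ Ico 1 m := ⟨by omega, by have := ham.2; omega⟩
      have hlt : u (a - 1) < u a := by
        refine lt_of_le_of_ne (hmono hpm ham (Nat.sub_le _ _)) fun heq => ?_
        exact Nat.find_min hex (m := a - 1) (by omega) ⟨hpm.1, by omega, heq.trans hua⟩
      refine ⟨u a - u (a - 1), by linarith, fun x hx hxa => ?_⟩
      have := hmono hx hpm (by omega)
      linarith
  have key : ∀ t, 0 < t → t ≤ gap →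
      2 * ∑ k ∈ Finset.Icc a j, (u j - v k) ≤ t * (Finset.Icc a j).card := by
    intro t ht htg
    have hw : MonotoneOn (fun k => if k ∈ Finset.Icc a j then u k - t else u k)
        (Finset.Ico 1 m) := by
      rw [Finset.coe_Ico]
      intro x hx y hy hxy
      have hu := hmono hx hy hxy
      simp only [Finset.mem_Icc]
      split_ifs with h1 h2 h2
      · linarith
      · linarith
      · have hxa : x < a := by
          by_contra! hax
          exact h1 ⟨hax, hxy.trans h2.2⟩
        have := hgap' x hx hxa
        have := hmono ham hy h2.1
        linarith
      · exact hu
    have hle := sub_nonneg.2 (hmin _ hw)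
    rw [← Finset.sum_sub_distrib, ← Finset.sum_subset (s₁ := Finset.Icc a j)] at hle
    · have e : ∑ k ∈ Finset.Icc a j, (((if k ∈ Finset.Icc a j then u k - t else u k) - v k) ^ 2 -
          (u k - v k) ^ 2) = ∑ k ∈ Finset.Icc a j, (t ^ 2 - 2 * t * (u j - v k)) := by
        refine Finset.sum_congr rfl fun k hk => ?_
        rw [if_pos hk, hblock k hk]; ring
      rw [e, Finset.sum_sub_distrib, ← Finset.mul_sum, Finset.sum_const, nsmul_eq_mul] at hle
      have : 0 ≤ t * (t * (Finset.Icc a j).card - 2 * ∑ k ∈ Finset.Icc a j, (u j - v k)) := by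
        linarith
      linarith [nonneg_of_mul_nonneg_right this ht]
    · intro k hk
      obtain ⟨h1, h2⟩ := Finset.mem_Icc.1 hk
      exact Finset.mem_Ico.2 ⟨ha1.trans h1, h2.trans_lt hj.2⟩
    · intro k _ hk
      rw [if_neg hk, sub_self]
  refine ⟨a, ha1, haj, ?_⟩
  by_contra! hpos
  set S := ∑ k ∈ Finset.Icc a j, (u j - v k)
  have hN : (0 : ℝ) < (Finset.Icc a j).card := by
    exact_mod_cast Finset.card_pos.2 ⟨a, Finset.mem_Icc.2 ⟨le_rfl, haj⟩⟩
  have h2 := key (min gap (S / (Finset.Icc a j).card)) (by positivity) (min_le_left _ _)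
  have h3 : min gap (S / (Finset.Icc a j).card) * (Finset.Icc a j).card ≤ S := by
    calc _ ≤ S / (Finset.Icc a j).card * (Finset.Icc a j).card := by
          gcongr; exact min_le_right _ _
      _ = S := by field_simp
  linarith

/-- Data that are at most `c` on `(K, j]` keep the isotonic regression at `j` close to or below `c`,
up to the averaged influence of the data on `[1, K]`. -/
lemma IsIsotonicRegression.mul_sub_le {m : ℕ} {v u : ℕ → ℝ} (h : IsIsotonicRegression m v u)
    {j K : ℕ} (hj : j ∈ Ico 1 m) (hK : K < j) {c τ : ℝ} (hv : ∀ k, K < k → k ≤ j → v k ≤ c)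
    (hτ : ∑ k ∈ Finset.Icc 1 K, |v k - c| ≤ τ) : ((j : ℝ) - K) * (u j - c) ≤ τ := by
  have hτ0 : 0 ≤ τ := (Finset.sum_nonneg fun _ _ => abs_nonneg _).trans hτ
  have hjK : (0 : ℝ) ≤ (j : ℝ) - K := by
    have : (K : ℝ) < j := by exact_mod_cast hK
    linarith
  rcases le_or_gt (u j) c with huc | huc
  · nlinarith
  obtain ⟨a, ha1, haj, ha⟩ := h.exists_sum_nonpos hj
  have hsum : ∑ k ∈ Finset.Icc a j, (v k - c) ≤ τ := by
    calc ∑ k ∈ Finset.Icc a j, (v k - c)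
        ≤ ∑ k ∈ Finset.Icc a j, (if k ∈ Finset.Icc 1 K then |v k - c| else 0) := by
          refine Finset.sum_le_sum fun k hk => ?_
          obtain ⟨h1, h2⟩ := Finset.mem_Icc.1 hk
          split_ifs with hkK
          · exact le_abs_self _
          · have := hv k (by rw [Finset.mem_Icc] at hkK; omega) h2
            linarith
      _ ≤ ∑ k ∈ Finset.Icc 1 j, (if k ∈ Finset.Icc 1 K then |v k - c| else 0) := by
          refine Finset.sum_le_sum_of_subset_of_nonneg (Finset.Icc_subset_Icc_left ha1)
            fun k _ _ => ?_
          split_ifs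
          · exact abs_nonneg _
          · exact le_rfl
      _ = ∑ k ∈ Finset.Icc 1 K, |v k - c| := by
          rw [Finset.sum_ite_mem, Finset.inter_eq_right.2 (Finset.Icc_subset_Icc_right hK.le)]
      _ ≤ τ := hτ
  have hcard : ∑ k ∈ Finset.Icc a j, (u j - c) = ((j : ℝ) + 1 - a) * (u j - c) := by
    rw [Finset.sum_const, Nat.card_Icc, nsmul_eq_mul, Nat.cast_sub (by omega)]
    push_cast; ring
  have hsplit : ∑ k ∈ Finset.Icc a j, (u j - c) =
      ∑ k ∈ Finset.Icc a j, (u j - v k) + ∑ k ∈ Finset.Icc a j, (v k - c) := by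
    rw [← Finset.sum_add_distrib]
    exact Finset.sum_congr rfl fun k _ => by ring
  have haK : a ≤ K := by
    by_contra! hlt
    have : 0 < ∑ k ∈ Finset.Icc a j, (u j - v k) :=
      Finset.sum_pos (fun k hk => by
        obtain ⟨h1, h2⟩ := Finset.mem_Icc.1 hk
        have := hv k (by omega) h2
        linarith) ⟨a, Finset.mem_Icc.2 ⟨le_rfl, haj⟩⟩
    linarith
  have haK' : (a : ℝ) ≤ K := by exact_mod_cast haK
  have : ((j : ℝ) - K) * (u j - c) ≤ ((j : ℝ) + 1 - a) * (u j - c) :=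
    mul_le_mul_of_nonneg_right (by linarith) (by linarith)
  linarith

lemma sum_Ico_one_reflect (m : ℕ) (f : ℕ → ℝ) :
    ∑ j ∈ Finset.Ico 1 m, f (m - j) = ∑ j ∈ Finset.Ico 1 m, f j := by
  refine Finset.sum_nbij' (fun j => m - j) (fun j => m - j) ?_ ?_ ?_ ?_ fun _ _ => rfl
  all_goals
    intro j hj
    simp only [Finset.mem_Ico] at hj ⊢
    omega

lemma monotoneOn_reflect {m : ℕ} {u : ℕ → ℝ} (h : MonotoneOn u (Finset.Ico 1 m)) :
    MonotoneOn (fun j => -u (m - j)) (Finset.Ico 1 m) := by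
  rw [Finset.coe_Ico] at h ⊢
  intro x hx y hy hxy
  simp only [mem_Ico] at hx hy
  exact neg_le_neg (h ⟨by omega, by omega⟩ ⟨by omega, by omega⟩ (by omega))

lemma IsIsotonicRegression.reflect {m : ℕ} {v u : ℕ → ℝ} (h : IsIsotonicRegression m v u) :
    IsIsotonicRegression m (fun j => -v (m - j)) (fun j => -u (m - j)) := by
  refine ⟨monotoneOn_reflect h.1, fun w hw => ?_⟩
  have h1 := h.2 _ (monotoneOn_reflect hw)
  have e1 : ∑ j ∈ Finset.Ico 1 m, (-u (m - j) - -v (m - j)) ^ 2 =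
      ∑ j ∈ Finset.Ico 1 m, (u j - v j) ^ 2 := by
    rw [← sum_Ico_one_reflect m fun j => (u j - v j) ^ 2]
    exact Finset.sum_congr rfl fun j _ => by ring
  have e2 : ∑ j ∈ Finset.Ico 1 m, (-w (m - j) - v j) ^ 2 =
      ∑ j ∈ Finset.Ico 1 m, (w j - -v (m - j)) ^ 2 := by
    rw [← sum_Ico_one_reflect m]
    refine Finset.sum_congr rfl fun j hj => ?_
    rw [Nat.sub_sub_self (Finset.mem_Ico.1 hj).2.le]; ring
  rw [e1, ← e2]
  exact h1

/-- The mirror image of `mul_sub_le`: data that are at least `c` on `[j, m - K)` keep the isotonic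
regression at `j` close to or above `c`. -/
lemma IsIsotonicRegression.mul_sub_le' {m : ℕ} {v u : ℕ → ℝ} (h : IsIsotonicRegression m v u)
    {j K : ℕ} (hj : j ∈ Ico 1 m) (hK : j + K < m) {c τ : ℝ}
    (hv : ∀ k, j ≤ k → k + K < m → c ≤ v k)
    (hτ : ∑ k ∈ Finset.Icc 1 K, |v (m - k) - c| ≤ τ) :
    ((m : ℝ) - j - K) * (c - u j) ≤ τ := by
  have hjm : m - (m - j) = j := by have := hj.2; omega
  have := h.reflect.mul_sub_le (j := m - j) (K := K) (c := -c) (τ := τ)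
    ⟨by have := hj.2; omega, by have := hj.1; omega⟩ (by omega)
    (fun k h1 h2 => neg_le_neg (hv _ (by omega) (by omega)))
    (by
      refine le_trans (le_of_eq (Finset.sum_congr rfl fun k _ => ?_)) hτ
      rw [← abs_neg]; congr 1; ring)
  rw [hjm, Nat.cast_sub hj.2.le] at this
  linarith

/-! ### Linear interpolation on the grid -/

lemma IsLinearInterpolation.eq_convexCombination {m : ℕ} {f : ℝ → ℝ}
    (h : IsLinearInterpolation m f) {j : ℕ} (hj : 1 ≤ j) (hjm : j + 1 < m) {p : ℝ}
    (hp : p ∈ Icc ((j : ℝ) / m) (((j + 1 : ℕ) : ℝ) / m)) :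
    f p = (1 - (p * m - j)) * f ((j : ℝ) / m) +
      (p * m - j) * f (((j + 1 : ℕ) : ℝ) / m) := by
  have hm : (m : ℝ) ≠ 0 := by
    have : 0 < m := by omega
    positivity
  rw [h j hj hjm p hp]
  have : ((j + 1 : ℕ) : ℝ) / m - (j : ℝ) / m = 1 / m := by push_cast; field_simp; ring
  rw [this]
  field_simp
  ring

lemma IsLinearInterpolation.continuousOn {m : ℕ} {f : ℝ → ℝ} (h : IsLinearInterpolation m f) :
    ContinuousOn f (Icc (1 / m : ℝ) (((m : ℝ) - 1) / m)) := by
  have key : ∀ k : ℕ, k + 1 < m → ContinuousOn f (Icc (1 / m : ℝ) (((k + 1 : ℕ) : ℝ) / m)) := by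
    intro k
    induction k with
    | zero =>
      intro _
      simp
    | succ k ih =>
      intro hk
      have hm : (0 : ℝ) < m := by exact_mod_cast (by omega : 0 < m)
      have h1 : (1 / m : ℝ) ≤ ((k + 1 : ℕ) : ℝ) / m := by
        gcongr
        exact_mod_cast Nat.le_add_left 1 k
      have h2 : ((k + 1 : ℕ) : ℝ) / m ≤ ((k + 1 + 1 : ℕ) : ℝ) / m := by
        gcongr
        omega
      rw [← Icc_union_Icc_eq_Icc h1 h2]
      refine (ih (by omega)).union_of_isClosed ?_ isClosed_Icc isClosed_Icc
      refine ContinuousOn.congr (f := fun p => (1 - (p * m - ((k + 1 : ℕ) : ℝ))) *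
        f (((k + 1 : ℕ) : ℝ) / m) + (p * m - ((k + 1 : ℕ) : ℝ)) *
        f (((k + 1 + 1 : ℕ) : ℝ) / m)) (by fun_prop) fun p hp =>
        h.eq_convexCombination (by omega) hk hp
  rcases Nat.lt_or_ge m 2 with hm | hm
  · have h01 : m = 0 ∨ m = 1 := by omega
    rcases h01 with rfl | rfl
    · simp
    · simp
  · obtain ⟨k, rfl⟩ : ∃ k, m = k + 2 := ⟨m - 2, by omega⟩
    have := key k (by omega)
    convert this using 3
    push_cast
    ring

/-- Every level of `[η, 1 - η]` lies in a cell of a grid of mesh at most `η / 2`, whose end points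
belong to `[η / 2, 1 - η / 2]`. -/
lemma exists_grid_cell {η p : ℝ} (hη : 0 < η) {m : ℕ} (hm : 2 ≤ η * m)
    (hp : p ∈ Icc η (1 - η)) : ∃ j : ℕ, 1 ≤ j ∧ j + 1 < m ∧
      p ∈ Icc ((j : ℝ) / m) (((j + 1 : ℕ) : ℝ) / m) ∧
      (j : ℝ) / m ∈ Icc (η / 2) (1 - η / 2) ∧
      ((j + 1 : ℕ) : ℝ) / m ∈ Icc (η / 2) (1 - η / 2) := by
  have hm0 : (0 : ℝ) < m := by
    by_contra! h
    nlinarith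
  have hpm : 2 ≤ p * m := hm.trans (by gcongr; exact hp.1)
  have hpm' : p * m ≤ m - η * m := by
    have := mul_le_mul_of_nonneg_right hp.2 hm0.le
    linarith
  have h1 : (⌊p * m⌋₊ : ℝ) ≤ p * m := Nat.floor_le (by linarith)
  have h2 : p * m < ⌊p * m⌋₊ + 1 := Nat.lt_floor_add_one _
  refine ⟨⌊p * m⌋₊, ?_, ?_, ⟨?_, ?_⟩, ⟨?_, ?_⟩, ⟨?_, ?_⟩⟩
  · exact Nat.le_floor (by push_cast; linarith)
  · have : (⌊p * m⌋₊ : ℝ) + 1 < m := by linarith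
    exact_mod_cast this
  · rw [div_le_iff₀ hm0]; exact h1
  · rw [le_div_iff₀ hm0]; push_cast; exact h2.le
  · rw [le_div_iff₀ hm0]; nlinarith [hp.1]
  · rw [div_le_iff₀ hm0]; nlinarith
  · rw [le_div_iff₀ hm0]; push_cast; nlinarith [hp.1]
  · rw [div_le_iff₀ hm0]; push_cast; nlinarith

/-- For fine grids, a linear interpolation that is close to a continuous curve at the grid points is
close to it between them. -/
lemma exists_forall_interpolation_close {β : ℝ → Fin (d + 1) → ℝ} {η : ℝ} (hη : 0 < η)
    (hβ : ContinuousOn β (Icc (η / 2) (1 - η / 2))) {ε : ℝ} (hε : 0 < ε) :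
    ∃ M : ℕ, ∀ m ≥ M, ∀ b : ℝ → Fin (d + 1) → ℝ,
      (∀ i, IsLinearInterpolation m fun p => b p i) →
      (∀ j : ℕ, (j : ℝ) / m ∈ Icc (η / 2) (1 - η / 2) →
        ‖b ((j : ℝ) / m) - β ((j : ℝ) / m)‖ ≤ ε / 2) →
      ∀ p ∈ Icc η (1 - η), ‖b p - β p‖ ≤ ε := by
  obtain ⟨δ, hδ, hu⟩ := Metric.uniformContinuousOn_iff.1
    (isCompact_Icc.uniformContinuousOn_of_continuous hβ) (ε / 2) (by positivity)
  obtain ⟨M, hM⟩ := exists_nat_gt (max (2 / η) (1 / δ))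
  refine ⟨M, fun m hm b hb hclose p hp => ?_⟩
  have hmM : (M : ℝ) ≤ m := by exact_mod_cast hm
  have hm1 : 2 ≤ η * m := by
    have := ((le_max_left _ _).trans_lt hM).le.trans hmM
    rw [div_le_iff₀ hη] at this
    linarith
  have hm2 : 1 / δ < m := ((le_max_right _ _).trans_lt hM).trans_le hmM
  have hm0 : (0 : ℝ) < m := (by positivity : (0 : ℝ) < 1 / δ).trans hm2
  have hmesh : 1 / (m : ℝ) < δ := by
    rw [div_lt_iff₀ hδ] at hm2
    rw [div_lt_iff₀ hm0]
    linarith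
  obtain ⟨j, hj1, hjm, hpj, hj, hj'⟩ := exists_grid_cell hη hm1 hp
  have hp' : p ∈ Icc (η / 2) (1 - η / 2) := ⟨by linarith [hp.1], by linarith [hp.2]⟩
  have hcell : ((j + 1 : ℕ) : ℝ) / m - (j : ℝ) / m = 1 / m := by push_cast; field_simp; ring
  have a1 := (dist_eq_norm (β ((j : ℝ) / m)) (β p)) ▸ hu _ hj _ hp' (by
    rw [Real.dist_eq, abs_lt]; constructor <;> linarith [hpj.1, hpj.2])
  have a2 := (dist_eq_norm (β (((j + 1 : ℕ) : ℝ) / m)) (β p)) ▸ hu _ hj' _ hp' (by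
    rw [Real.dist_eq, abs_lt]; constructor <;> linarith [hpj.1, hpj.2])
  have c1 : ‖b ((j : ℝ) / m) - β p‖ ≤ ε := by
    have := norm_sub_le_norm_sub_add_norm_sub (b ((j : ℝ) / m)) (β ((j : ℝ) / m)) (β p)
    linarith [hclose j hj]
  have c2 : ‖b (((j + 1 : ℕ) : ℝ) / m) - β p‖ ≤ ε := by
    have := norm_sub_le_norm_sub_add_norm_sub (b (((j + 1 : ℕ) : ℝ) / m))
      (β (((j + 1 : ℕ) : ℝ) / m)) (β p)
    linarith [hclose (j + 1) hj']
  set t := p * m - j with ht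
  have ht0 : 0 ≤ t := by
    have := (div_le_iff₀ hm0).1 hpj.1
    linarith
  have ht1 : t ≤ 1 := by
    have := (le_div_iff₀ hm0).1 hpj.2
    push_cast at this
    linarith
  have e : b p - β p = (1 - t) • (b ((j : ℝ) / m) - β p) +
      t • (b (((j + 1 : ℕ) : ℝ) / m) - β p) := by
    funext i
    have := (hb i).eq_convexCombination hj1 hjm hpj
    simp only [Pi.sub_apply, Pi.add_apply, Pi.smul_apply, smul_eq_mul]
    rw [this]; ring
  calc ‖b p - β p‖ ≤ (1 - t) * ‖b ((j : ℝ) / m) - β p‖ +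
        t * ‖b (((j + 1 : ℕ) : ℝ) / m) - β p‖ := by
        rw [e]
        refine (norm_add_le _ _).trans (le_of_eq ?_)
        rw [norm_smul, norm_smul, Real.norm_of_nonneg ht0,
          Real.norm_of_nonneg (by linarith : 0 ≤ 1 - t)]
    _ ≤ (1 - t) * ε + t * ε := by
        have : 0 ≤ 1 - t := by linarith
        gcongr
    _ = ε := by ring

/-! ### Consistency of the interpolated and of the isotonised estimates -/

lemma mem_Ico_of_div_mem_Icc {j m : ℕ} {η : ℝ} (hη : 0 < η) (h : (j : ℝ) / m ∈ Icc η (1 - η)) :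
    j ∈ Ico 1 m := by
  have hpos : 0 < (j : ℝ) / m := hη.trans_le h.1
  have hj : j ≠ 0 := by rintro rfl; simp at hpos
  have hm : m ≠ 0 := by rintro rfl; simp at hpos
  have hm' : (0 : ℝ) < m := by positivity
  have h2 : (j : ℝ) / m < 1 := by linarith [h.2]
  rw [div_lt_one hm'] at h2
  exact ⟨Nat.one_le_iff_ne_zero.2 hj, by exact_mod_cast h2⟩

/-- `b` is a linearly interpolated quantile regression estimate from the sample `s`. -/
def IsEstimate (m : ℕ) (s : Sample d) (b : ℝ → Fin (d + 1) → ℝ) : Prop :=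
  IsOQREstimate m s.1 (fun k => (s.2 k).1) (fun k => (s.2 k).2) b

lemma IsEstimate.isMinimiser {m : ℕ} {s : Sample d} {b : ℝ → Fin (d + 1) → ℝ}
    (h : IsEstimate m s b) {j : ℕ} (hj : j ∈ Ico 1 m) :
    IsMinimiser s ((j : ℝ) / m) (b ((j : ℝ) / m)) :=
  h.1 j (Finset.mem_Ico.2 hj)

/-- Consistency of quantile regression with linear interpolation. The required fineness of the grid
does not depend on the sample. -/
theorem ObeysLLN.exists_eventually_estimate_close {μ : Measure (Obs d)} {l : Filter (Sample d)}
    (hl : ObeysLLN μ l) {β : ℝ → Fin (d + 1) → ℝ} (hμ : IsQuantilePopulation μ β) {η : ℝ}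
    (hη : η ∈ Ioo (0 : ℝ) (1 / 2)) {ε : ℝ} (hε : 0 < ε) :
    ∃ M : ℕ, ∀ᶠ s in l, ∀ m ≥ M, ∀ b, IsEstimate m s b →
      ∀ p ∈ Icc η (1 - η), ‖b p - β p‖ ≤ ε := by
  have hη2 : η / 2 ∈ Ioo (0 : ℝ) (1 / 2) := ⟨by linarith [hη.1], by linarith [hη.1, hη.2]⟩
  obtain ⟨M, hM⟩ := exists_forall_interpolation_close hη.1 (hμ.continuousOn _ hη2) hε
  refine ⟨M, (hl.eventually_norm_sub_le hμ hη2 (half_pos hε)).mono fun s hs m hm b hb => ?_⟩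
  exact hM m hm b hb.2 fun j hj => hs _ hj _ (hb.isMinimiser (mem_Ico_of_div_mem_Icc hη2.1 hj))

/-- Consistency of the isotonised estimates at the grid points. The data on the central part of the
grid are uniformly close to the nondecreasing curve `β`, and the data near the ends of the grid, on
which there is no uniform control, are too small on average to move the isotonic regression. -/
theorem ObeysLLN.eventually_isotonic_close {μ : Measure (Obs d)} {l : Filter (Sample d)}
    (hl : ObeysLLN μ l) {β : ℝ → Fin (d + 1) → ℝ} (hμ : IsQuantilePopulation μ β)
    (hβ : ∀ i, ∀ η ∈ Ioo (0 : ℝ) (1 / 2), MonotoneOn (fun p => β p i) (Icc η (1 - η)))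
    (hz : Integrable (fun w : Obs d => w.2) μ) {η : ℝ} (hη : η ∈ Ioo (0 : ℝ) (1 / 2)) {ε : ℝ}
    (hε : 0 < ε) :
    ∀ᶠ s in l, ∀ (m : ℕ) (b b' : ℝ → Fin (d + 1) → ℝ), IsEstimate m s b → IsIsotonised m b b' →
      ∀ j : ℕ, (j : ℝ) / m ∈ Icc η (1 - η) → ‖b' ((j : ℝ) / m) - β ((j : ℝ) / m)‖ ≤ ε := by
  obtain ⟨B, hB⟩ :=
    (isCompact_Icc.image_of_continuousOn (hμ.continuousOn η hη)).isBounded.exists_norm_le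
  have hB0 : 0 ≤ B := (norm_nonneg _).trans (hB _ (mem_image_of_mem β
    (⟨le_rfl, by linarith [hη.2]⟩ : η ∈ Icc η (1 - η))))
  have hη0 := hη.1
  have hτ : 0 < η * ε / 16 := by positivity
  obtain ⟨c, hc0, hc⟩ := hl.eventually_coercive hμ
  obtain ⟨η₁, hη₁, h1⟩ := hl.eventually_sum_norm_left_le hz hc0 hc hτ
  obtain ⟨η₂, hη₂, h2⟩ := hl.eventually_sum_norm_right_le hz hc0 hc hτ
  obtain ⟨η₀, hη₀, hη₀1, hη₀2, hη₀3, hη₀4⟩ : ∃ η₀ > 0, η₀ ≤ η₁ ∧ η₀ ≤ η₂ ∧ η₀ ≤ η / 2 ∧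
      η₀ * (B + ε) ≤ η * ε / 16 := by
    refine ⟨min (min η₁ η₂) (min (η / 2) (η * ε / 16 / (B + ε))), by positivity,
      (min_le_left _ _).trans (min_le_left _ _), (min_le_left _ _).trans (min_le_right _ _),
      (min_le_right _ _).trans (min_le_left _ _), ?_⟩
    rw [← le_div_iff₀ (by positivity)]
    exact (min_le_right _ _).trans (min_le_right _ _)
  have hη₀m : η₀ ∈ Ioo (0 : ℝ) (1 / 2) := ⟨hη₀, by linarith [hη.2]⟩
  filter_upwards [h1, h2, hl.eventually_norm_sub_le hμ hη₀m (half_pos hε)]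
    with s hs1 hs2 hs3 m b b' hb hb' j hj
  have hjm := mem_Ico_of_div_mem_Icc hη0 hj
  have hm : 0 < m := by have := hjm.2; omega
  have hm' : (0 : ℝ) < m := by exact_mod_cast hm
  set K := ⌊η₀ * m⌋₊ with hKd
  have hK : (K : ℝ) ≤ η₀ * m := Nat.floor_le (by positivity)
  have hK' : η₀ * m < K + 1 := Nat.lt_floor_add_one _
  have hjη : η * m ≤ j := (le_div_iff₀ hm').1 hj.1
  have hjη' : (j : ℝ) ≤ (1 - η) * m := (div_le_iff₀ hm').1 hj.2
  have hηm : η₀ * m ≤ η / 2 * m := by gcongr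
  have hηm0 : 0 < η / 2 * m := by positivity
  have hKj : K < j := by
    have : (K : ℝ) < j := by linarith
    exact_mod_cast this
  have hjK : j + K < m := by
    have : (j : ℝ) + K < m := by linarith
    exact_mod_cast this
  have hcentral : ∀ k : ℕ, K < k → k + K < m →
      (k : ℝ) / m ∈ Icc η₀ (1 - η₀) := fun k h1 h2 => by
    have h1' : (K : ℝ) + 1 ≤ k := by exact_mod_cast h1
    have h2' : (k : ℝ) + K + 1 ≤ m := by exact_mod_cast h2
    refine ⟨?_, ?_⟩
    · rw [le_div_iff₀ hm']; linarith
    · rw [div_le_iff₀ hm']; linarith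
  have hsum1 : ∑ k ∈ Finset.Icc 1 K, ‖b ((k : ℝ) / m)‖ ≤ η * ε / 16 * m :=
    hs1 m K (fun k => b ((k : ℝ) / m)) hm (hK.trans (by gcongr)) fun k hk =>
      hb.isMinimiser ⟨(Finset.mem_Icc.1 hk).1, by have := (Finset.mem_Icc.1 hk).2; omega⟩
  have hsum2 : ∑ k ∈ Finset.Icc 1 K, ‖b (((m - k : ℕ) : ℝ) / m)‖ ≤ η * ε / 16 * m :=
    hs2 m K (fun k => b (((m - k : ℕ) : ℝ) / m)) hm (hK.trans (by gcongr)) fun k hk => by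
      obtain ⟨hk1, hk2⟩ := Finset.mem_Icc.1 hk
      have e : 1 - (k : ℝ) / m = ((m - k : ℕ) : ℝ) / m := by
        rw [Nat.cast_sub (by omega)]; field_simp
      rw [e]
      exact hb.isMinimiser ⟨by omega, by omega⟩
  have hKB : K * (B + ε) ≤ η * ε / 16 * m := by
    calc K * (B + ε) ≤ η₀ * m * (B + ε) := by gcongr
      _ = η₀ * (B + ε) * m := by ring
      _ ≤ _ := by gcongr
  rw [pi_norm_le_iff_of_nonneg hε.le]
  intro i
  have hβi : |β ((j : ℝ) / m) i| ≤ B := (norm_le_pi_norm _ i).trans (hB _ (mem_image_of_mem β hj))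
  rw [abs_le] at hβi
  -- the averaged influence of an end of the grid
  have hend : ∀ (q : ℕ → ℝ) (c : ℝ), |c| ≤ B + ε →
      ∑ k ∈ Finset.Icc 1 K, ‖b (q k)‖ ≤ η * ε / 16 * m →
      ∑ k ∈ Finset.Icc 1 K, |b (q k) i - c| ≤ η * ε / 8 * m := fun q c hcB hf => by
    calc ∑ k ∈ Finset.Icc 1 K, |b (q k) i - c|
        ≤ ∑ k ∈ Finset.Icc 1 K, (‖b (q k)‖ + (B + ε)) := by
          refine Finset.sum_le_sum fun k _ => (abs_sub _ _).trans ?_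
          exact add_le_add (norm_le_pi_norm (b (q k)) i) hcB
      _ = ∑ k ∈ Finset.Icc 1 K, ‖b (q k)‖ + K * (B + ε) := by
          rw [Finset.sum_add_distrib, Finset.sum_const, Nat.card_Icc, nsmul_eq_mul]
          simp
      _ ≤ η * ε / 16 * m + η * ε / 16 * m := add_le_add hf hKB
      _ = η * ε / 8 * m := by ring
  have hv : ∀ k : ℕ, K < k → k + K < m →
      |b ((k : ℝ) / m) i - β ((k : ℝ) / m) i| ≤ ε / 2 := fun k h1 h2 =>
    (norm_le_pi_norm (b ((k : ℝ) / m) - β ((k : ℝ) / m)) i).trans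
      (hs3 _ (hcentral k h1 h2) _ (hb.isMinimiser ⟨by omega, by omega⟩))
  have hup := (hb' i).1.mul_sub_le hjm hKj (c := β ((j : ℝ) / m) i + ε / 2)
    (τ := η * ε / 8 * m) (fun k h1 h2 => by
      have hk := (abs_le.1 (hv k h1 (by omega))).2
      have := hβ i η₀ hη₀m (hcentral k h1 (by omega)) (hcentral j hKj hjK) (by gcongr)
      simp only at this
      linarith)
    (hend (fun k => (k : ℝ) / m) _
      (abs_le.2 ⟨by linarith, by linarith⟩) hsum1)
  have hlo := (hb' i).1.mul_sub_le' hjm hjK (c := β ((j : ℝ) / m) i - ε / 2)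
    (τ := η * ε / 8 * m) (fun k h1 h2 => by
      have hk := (abs_le.1 (hv k (by omega) h2)).1
      have := hβ i η₀ hη₀m (hcentral j hKj hjK) (hcentral k (by omega) h2) (by gcongr)
      simp only at this
      linarith)
    (hend (fun k => ((m - k : ℕ) : ℝ) / m) _
      (abs_le.2 ⟨by linarith, by linarith⟩) hsum2)
  have hcancel : ∀ A D : ℝ, η / 2 * m ≤ A → A * D ≤ η * ε / 8 * m → D ≤ ε / 2 := fun A D hA hD => by
    by_contra! hlt
    have : η / 2 * m * (ε / 2) < A * D :=
      mul_lt_mul' hA hlt (by positivity) (hηm0.trans_le hA)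
    nlinarith [mul_pos (mul_pos hη0 hε) hm']
  have r1 := hcancel _ _ (by linarith) hup
  have r2 := hcancel _ _ (by linarith) hlo
  rw [Real.norm_eq_abs, abs_le, Pi.sub_apply]
  constructor <;> linarith

/-- Consistency of the isotonised estimates with linear interpolation. -/
theorem ObeysLLN.exists_eventually_isotonised_close {μ : Measure (Obs d)} {l : Filter (Sample d)}
    (hl : ObeysLLN μ l) {β : ℝ → Fin (d + 1) → ℝ} (hμ : IsQuantilePopulation μ β)
    (hβ : ∀ i, ∀ η ∈ Ioo (0 : ℝ) (1 / 2), MonotoneOn (fun p => β p i) (Icc η (1 - η)))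
    (hz : Integrable (fun w : Obs d => w.2) μ) {η : ℝ} (hη : η ∈ Ioo (0 : ℝ) (1 / 2)) {ε : ℝ}
    (hε : 0 < ε) :
    ∃ M : ℕ, ∀ᶠ s in l, ∀ m ≥ M, ∀ b b', IsEstimate m s b → IsIsotonised m b b' →
      ∀ p ∈ Icc η (1 - η), ‖b' p - β p‖ ≤ ε := by
  have hη2 : η / 2 ∈ Ioo (0 : ℝ) (1 / 2) := ⟨by linarith [hη.1], by linarith [hη.1, hη.2]⟩
  obtain ⟨M, hM⟩ := exists_forall_interpolation_close hη.1 (hμ.continuousOn _ hη2) hε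
  refine ⟨M, (hl.eventually_isotonic_close hμ hβ hz hη2 (half_pos hε)).mono
    fun s hs m hm b b' hb hb' => ?_⟩
  exact hM m hm b' (fun i => (hb' i).2) fun j hj => hs m b b' hb hb' j hj

/-! ### Convergence in probability as convergence along a filter -/

/-- The filter on `ℕ × Ω` of the events `S` whose `n`-th sections `S_n` have probability tending to
`1`. Convergence along it is convergence in probability as `n → ∞`. The probability of the
complement is an outer measure, so that no measurability is required. -/
def highProb {Ω : Type*} [MeasurableSpace Ω] (P : Measure Ω) : Filter (ℕ × Ω) where
  sets := {S | Tendsto (fun n => P {ω | (n, ω) ∉ S}) atTop (𝓝 0)}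
  univ_sets := by simp
  sets_of_superset := fun {S T} hS hST =>
    tendsto_of_tendsto_of_tendsto_of_le_of_le tendsto_const_nhds hS (fun _ => zero_le)
      fun n => measure_mono fun _ hω h => hω (hST h)
  inter_sets := fun {S T} hS hT => by
    have hadd := Tendsto.add hS hT
    rw [add_zero] at hadd
    refine tendsto_of_tendsto_of_tendsto_of_le_of_le tendsto_const_nhds hadd (fun _ => zero_le)
      fun n => (measure_mono fun ω hω => ?_).trans (measure_union_le _ _)
    by_contra h
    simp only [mem_union, mem_ofPred_eq, not_or, not_not] at h
    exact hω h

lemma eventually_highProb {Ω : Type*} [MeasurableSpace Ω] {P : Measure Ω} {S : ℕ × Ω → Prop} :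
    (∀ᶠ q in highProb P, S q) ↔ Tendsto (fun n => P {ω | ¬ S (n, ω)}) atTop (𝓝 0) :=
  Iff.rfl

instance highProb_neBot {Ω : Type*} [MeasurableSpace Ω] (P : Measure Ω) [IsProbabilityMeasure P] :
    NeBot (highProb P) := by
  refine ⟨fun h => ?_⟩
  have : ∀ᶠ _ in highProb P, False := by rw [h]; exact eventually_bot
  rw [eventually_highProb] at this
  simp at this

lemma tendsto_highProb {Ω : Type*} [MeasurableSpace Ω] {P : Measure Ω} {F : ℕ → Ω → ℝ} {a : ℝ}
    (h : TendstoInMeasure P F atTop fun _ => a) :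
    Tendsto (fun q : ℕ × Ω => F q.1 q.2) (highProb P) (𝓝 a) := by
  rw [EMetric.tendsto_nhds]
  intro ε hε
  rw [eventually_highProb]
  simpa only [not_lt] using h ε hε

/-- The sample of the first `n` of a sequence of random observations. -/
def sampleOf {Ω : Type*} (W : ℕ → Ω → Obs d) (q : ℕ × Ω) : Sample d := (q.1, fun k => W k q.2)

/-- Independent identically distributed observations obey the law of large numbers with high
probability. -/
theorem obeysLLN_of_iid {Ω : Type*} [MeasurableSpace Ω] {P : Measure Ω} [IsProbabilityMeasure P]
    {W : ℕ → Ω → Obs d} (hW : ∀ k, Measurable (W k)) (hindep : iIndepFun W P)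
    {μ : Measure (Obs d)} (hlaw : ∀ k, P.map (W k) = μ) :
    ObeysLLN μ ((highProb P).map (sampleOf W)) := by
  intro φ hφm hφ
  rw [tendsto_map'_iff]
  have hid : ∀ k, IdentDistrib (φ ∘ W k) (φ ∘ W 0) P P := fun k =>
    IdentDistrib.comp ⟨(hW k).aemeasurable, (hW 0).aemeasurable, by rw [hlaw, hlaw]⟩ hφm
  have hint : Integrable (φ ∘ W 0) P := by
    rw [← hlaw 0] at hφ
    exact (integrable_map_measure hφm.aestronglyMeasurable (hW 0).aemeasurable).1 hφ
  have h := strong_law_ae (μ := P) (fun k => φ ∘ W k) hint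
    (fun i j hij => (hindep.indepFun hij).comp hφm hφm) hid
  have e : ∫ ω, (φ ∘ W 0) ω ∂P = ∫ w, φ w ∂μ := by
    rw [← hlaw 0, integral_map (hW 0).aemeasurable hφm.aestronglyMeasurable]
    rfl
  rw [e] at h
  have hmeas : ∀ n : ℕ, AEStronglyMeasurable
      (fun ω => (n : ℝ)⁻¹ • ∑ k ∈ Finset.range n, (φ ∘ W k) ω) P := fun n => by
    refine Measurable.aestronglyMeasurable ?_
    simp only [smul_eq_mul]
    exact (Finset.measurable_sum _ fun k _ => hφm.comp (hW k)).const_mul _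
  refine (tendsto_highProb (tendstoInMeasure_of_tendsto_ae hmeas h)).congr fun q => ?_
  simp only [smul_eq_mul, Function.comp_apply, emean, sampleOf]

/-! ### Consequences of the convergence of the design -/

/-- The covariates, preceded by the constant `1`. -/
def augment (x : Fin d → ℝ) : Fin (d + 1) → ℝ := Fin.cons 1 x

lemma linPred_eq_dotProduct (b : Fin (d + 1) → ℝ) (x : Fin d → ℝ) :
    linPred b x = ∑ i, b i * augment x i := by
  simp [linPred, augment, Fin.sum_univ_succ]

lemma DesignConverges.exists_tendsto {Ω : Type*} [MeasurableSpace Ω] {P : Measure Ω}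
    {Xs : ℕ → Ω → Fin d → ℝ} (h : DesignConverges P Xs) (Zs : ℕ → Ω → ℝ) :
    ∃ A : Matrix (Fin (d + 1)) (Fin (d + 1)) ℝ, A.PosDef ∧ ∀ i j,
      Tendsto (emean fun w : Obs d => augment w.1 i * augment w.1 j)
        ((highProb P).map (sampleOf fun k ω => (Xs k ω, Zs k ω))) (𝓝 (A i j)) := by
  obtain ⟨A, hA, h⟩ := h
  refine ⟨A, hA, fun i j => ?_⟩
  rw [tendsto_map'_iff]
  refine (tendsto_highProb (h i j)).congr fun q => ?_
  simp only [Matrix.smul_apply, Matrix.mul_apply, Matrix.transpose_apply, designMatrix,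
    Matrix.of_apply, smul_eq_mul, Function.comp_apply, emean, sampleOf, augment]
  rw [Finset.sum_range fun k => (Fin.cons 1 (Xs k q.2) : Fin (d + 1) → ℝ) i *
    (Fin.cons 1 (Xs k q.2) : Fin (d + 1) → ℝ) j]

/-- If the empirical second moments of `φ` converge, then `φ²` is integrable: by truncation, the
limit bounds the second moment. -/
lemma ObeysLLN.integrable_sq {μ : Measure (Obs d)} [IsProbabilityMeasure μ]
    {l : Filter (Sample d)} [NeBot l] (hl : ObeysLLN μ l) {φ : Obs d → ℝ} (hφ : Measurable φ)
    {a : ℝ} (h : Tendsto (emean fun w => φ w ^ 2) l (𝓝 a)) :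
    Integrable (fun w => φ w ^ 2) μ := by
  have hm : ∀ K : ℕ, Measurable fun w => min (φ w ^ 2) K := fun K =>
    (hφ.pow_const 2).min measurable_const
  have h0 : ∀ (K : ℕ) w, 0 ≤ min (φ w ^ 2) (K : ℝ) := fun K w =>
    le_min (sq_nonneg _) K.cast_nonneg
  have hint : ∀ K : ℕ, Integrable (fun w => min (φ w ^ 2) K) μ := fun K =>
    (integrable_const (K : ℝ)).mono' (hm K).aestronglyMeasurable
      (Eventually.of_forall fun w => by
        rw [Real.norm_of_nonneg (h0 K w)]; exact min_le_right _ _)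
  have hle : ∀ K : ℕ, ∫⁻ w, ENNReal.ofReal (min (φ w ^ 2) K) ∂μ ≤ ENNReal.ofReal a := fun K => by
    rw [← ofReal_integral_eq_lintegral_ofReal (hint K) (Eventually.of_forall (h0 K))]
    exact ENNReal.ofReal_le_ofReal
      (le_of_tendsto_of_tendsto' (hl _ (hm K) (hint K)) h fun s =>
        emean_mono (fun w => min_le_left _ _) s)
  have hlim := lintegral_tendsto_of_tendsto_of_monotone (μ := μ)
    (f := fun K w => ENNReal.ofReal (min (φ w ^ 2) (K : ℕ)))
    (F := fun w => ENNReal.ofReal (φ w ^ 2))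
    (fun K => (hm K).ennreal_ofReal.aemeasurable)
    (Eventually.of_forall fun w K L hKL => ENNReal.ofReal_le_ofReal
      (min_le_min_left _ (by exact_mod_cast hKL)))
    (Eventually.of_forall fun w => tendsto_const_nhds.congr' (by
      filter_upwards [eventually_ge_atTop ⌈φ w ^ 2⌉₊] with K hK
      rw [min_eq_left ((Nat.le_ceil _).trans (by exact_mod_cast hK))]))
  refine ⟨(hφ.pow_const 2).aestronglyMeasurable, ?_⟩
  rw [hasFiniteIntegral_iff_ofReal (Eventually.of_forall fun w => sq_nonneg _)]
  exact (le_of_tendsto' hlim hle).trans_lt ENNReal.ofReal_lt_top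

lemma ObeysLLN.integrable_weight {μ : Measure (Obs d)} [IsProbabilityMeasure μ]
    {l : Filter (Sample d)} [NeBot l] (hl : ObeysLLN μ l)
    {A : Matrix (Fin (d + 1)) (Fin (d + 1)) ℝ}
    (hA : ∀ i j, Tendsto (emean fun w : Obs d => augment w.1 i * augment w.1 j) l (𝓝 (A i j))) :
    Integrable (fun w : Obs d => weight w.1) μ := by
  refine (integrable_const 1).add (integrable_finsetSum _ fun i _ => ?_)
  have hm : Measurable fun w : Obs d => w.1 i := (measurable_pi_apply i).comp measurable_fst
  have hsq := hl.integrable_sq hm (a := A i.succ i.succ) (by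
    simpa [augment, sq] using hA i.succ i.succ)
  refine ((integrable_const (1 : ℝ)).add hsq).mono' hm.abs.aestronglyMeasurable
    (Eventually.of_forall fun w => ?_)
  rw [Real.norm_eq_abs, abs_abs]
  simp only [Pi.add_apply]
  nlinarith [sq_nonneg (|w.1 i| - 1), sq_abs (w.1 i)]

/-- A linear predictor that vanishes almost surely has empirical second moment tending to `0`, so
that its coefficient vector is a null vector of the limit of the design. -/
lemma ObeysLLN.eq_zero_of_linPred_ae_eq_zero {μ : Measure (Obs d)} {l : Filter (Sample d)}
    [NeBot l] (hl : ObeysLLN μ l) {A : Matrix (Fin (d + 1)) (Fin (d + 1)) ℝ} (hpos : A.PosDef)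
    (hA : ∀ i j, Tendsto (emean fun w : Obs d => augment w.1 i * augment w.1 j) l (𝓝 (A i j)))
    {v : Fin (d + 1) → ℝ} (hv : ∀ᵐ w ∂μ, linPred v w.1 = 0) : v = 0 := by
  by_contra hne
  have hae : (fun w : Obs d => linPred v w.1 ^ 2) =ᵐ[μ] fun _ => (0 : ℝ) :=
    hv.mono fun w hw => by simp [hw]
  have h1 := hl (fun w => linPred v w.1 ^ 2)
    (((measurable_linPred v).comp measurable_fst).pow_const 2)
    ((integrable_zero _ _ _).congr hae.symm)
  rw [integral_congr_ae hae, integral_zero] at h1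
  have h2 : Tendsto (fun s => ∑ i, ∑ j, v i * v j *
      emean (fun w : Obs d => augment w.1 i * augment w.1 j) s) l
      (𝓝 (∑ i, ∑ j, v i * v j * A i j)) :=
    tendsto_finsetSum _ fun i _ => tendsto_finsetSum _ fun j _ => (hA i j).const_mul _
  have e : emean (fun w : Obs d => linPred v w.1 ^ 2) = fun s => ∑ i, ∑ j, v i * v j *
      emean (fun w : Obs d => augment w.1 i * augment w.1 j) s := by
    funext s
    simp only [emean, linPred_eq_dotProduct, Finset.mul_sum, sq, Finset.sum_mul]
    rw [Finset.sum_comm]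
    refine Finset.sum_congr rfl fun i _ => ?_
    rw [Finset.sum_comm]
    exact Finset.sum_congr rfl fun j _ => Finset.sum_congr rfl fun k _ => by ring
  rw [e] at h1
  have h0 : ∑ i, ∑ j, v i * v j * A i j = 0 := tendsto_nhds_unique h2 h1
  have hp := hpos.dotProduct_mulVec_pos hne
  have e2 : star v ⬝ᵥ A.mulVec v = ∑ i, ∑ j, v i * v j * A i j := by
    simp only [dotProduct, Matrix.mulVec, Pi.star_apply, star_trivial, Finset.mul_sum]
    exact Finset.sum_congr rfl fun i _ => Finset.sum_congr rfl fun j _ => by ring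
  rw [e2, h0] at hp
  exact lt_irrefl _ hp

/-! ### The population objective -/

/-- The part of the loss difference `ρ_p(z - c) - ρ_p(z - q)` left after subtracting its linear part
`(c - q) (𝟙(z ≤ q) - p)`. -/
noncomputable def knightRemainder (q c z : ℝ) : ℝ :=
  if q < z then max (c - z) 0 else max (z - c) 0

/-- Knight's identity. -/
lemma rho_sub_rho (p q c z : ℝ) :
    rho p (z - c) - rho p (z - q) =
      (c - q) * ((Iic q).indicator 1 z - p) + knightRemainder q c z := by
  rw [rho_eq, rho_eq, knightRemainder]
  split_ifs with h
  · rw [indicator_of_notMem (by simpa using h), max_eq_right (by linarith : -(z - q) ≤ 0), neg_sub]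
    ring
  · have hz : z ≤ q := not_lt.1 h
    rw [indicator_of_mem (by simpa using hz), max_eq_left (by linarith : 0 ≤ -(z - q)),
      Pi.one_apply]
    have : max (-(z - c)) 0 = c - z + max (z - c) 0 := by
      rcases le_total z c with h' | h'
      · rw [max_eq_left (by linarith), max_eq_right (by linarith)]; ring
      · rw [max_eq_right (by linarith), max_eq_left (by linarith)]; ring
    rw [this]; ring

lemma knightRemainder_nonneg (q c z : ℝ) : 0 ≤ knightRemainder q c z := by
  unfold knightRemainder; split_ifs <;> exact le_max_right _ _

lemma integrable_rho_sub_rho {p : ℝ} (h0 : 0 ≤ p) (h1 : p ≤ 1) (ν : Measure ℝ)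
    [IsProbabilityMeasure ν] (q c : ℝ) :
    Integrable (fun z => rho p (z - c) - rho p (z - q)) ν := by
  refine (integrable_const |c - q|).mono' ?_ (Eventually.of_forall fun z => ?_)
  · exact (((measurable_rho p).comp (measurable_id.sub_const c)).sub
      ((measurable_rho p).comp (measurable_id.sub_const q))).aestronglyMeasurable
  · rw [Real.norm_eq_abs]
    refine (abs_rho_sub_le h0 h1 _ _).trans (le_of_eq ?_)
    rw [← abs_neg]; congr 1; ring

lemma integral_rho_sub_rho {p : ℝ} (h0 : 0 ≤ p) (h1 : p ≤ 1) {ν : Measure ℝ}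
    [IsProbabilityMeasure ν] {q : ℝ} (hq : cdf ν q = p) (c : ℝ) :
    Integrable (knightRemainder q c) ν ∧
      ∫ z, (rho p (z - c) - rho p (z - q)) ∂ν = ∫ z, knightRemainder q c z ∂ν := by
  have hi : Integrable ((Iic q).indicator (1 : ℝ → ℝ)) ν :=
    (integrable_const (1 : ℝ)).indicator measurableSet_Iic
  have hlin : Integrable (fun z => (c - q) * ((Iic q).indicator 1 z - p)) ν :=
    (hi.sub (integrable_const p)).const_mul _
  have hR : Integrable (knightRemainder q c) ν := by
    refine ((integrable_rho_sub_rho h0 h1 ν q c).sub hlin).congr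
      (Eventually.of_forall fun z => ?_)
    simp only [Pi.sub_apply, rho_sub_rho]
    ring
  refine ⟨hR, ?_⟩
  simp only [rho_sub_rho]
  rw [integral_add hlin hR, integral_const_mul, integral_sub hi (integrable_const p),
    integral_indicator_one measurableSet_Iic, ← cdf_eq_real, hq]
  simp

/-- For a distribution with strictly increasing distribution function the expected loss has its
only minimum at the quantile. -/
lemma eq_of_integral_rho_sub_rho_eq_zero {p : ℝ} (h0 : 0 ≤ p) (h1 : p ≤ 1) {ν : Measure ℝ}
    [IsProbabilityMeasure ν] {q : ℝ} (hq : cdf ν q = p) (hmono : StrictMono (cdf ν)) {c : ℝ}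
    (h : ∫ z, (rho p (z - c) - rho p (z - q)) ∂ν = 0) : c = q := by
  obtain ⟨hR, e⟩ := integral_rho_sub_rho h0 h1 hq c
  rw [e] at h
  have hae := (integral_eq_zero_iff_of_nonneg (knightRemainder_nonneg q c) hR).1 h
  -- between `c` and `q` the remainder is positive
  have hpos : ∀ a b, a < b → ν (Ioo a b) ≠ 0 := fun a b hab => by
    have h2 : ν (Ioc a ((a + b) / 2)) ≠ 0 := by
      rw [← measure_cdf ν, StieltjesFunction.measure_Ioc]
      have := hmono (by linarith : a < (a + b) / 2)
      simp only [ne_eq, ENNReal.ofReal_eq_zero, not_le]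
      linarith
    have hsub : Ioc a ((a + b) / 2) ⊆ Ioo a b := fun z hz => ⟨hz.1, hz.2.trans_lt (by linarith)⟩
    exact fun h3 => h2 (measure_mono_null hsub h3)
  by_contra hne
  rcases lt_or_gt_of_ne hne with hlt | hlt
  · refine hpos c q hlt (measure_mono_null (fun z hz => ?_) (ae_iff.1 hae))
    rw [mem_ofPred_eq]
    intro hz0
    simp only [knightRemainder, not_lt.2 hz.2.le, if_false, Pi.zero_apply] at hz0
    have := le_max_left (z - c) 0
    linarith [hz.1]
  · refine hpos q c hlt (measure_mono_null (fun z hz => ?_) (ae_iff.1 hae))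
    rw [mem_ofPred_eq]
    intro hz0
    simp only [knightRemainder, hz.1, if_true, Pi.zero_apply] at hz0
    have := le_max_left (c - z) 0
    linarith [hz.2]

/-! ### The conditional distributions of the model -/

lemma cdf_map_log {ν : Measure ℝ} [IsProbabilityMeasure ν] (h0 : cdf ν 0 = 0) (z : ℝ) :
    cdf (ν.map Real.log) z = cdf ν (Real.exp z) := by
  have : IsProbabilityMeasure (ν.map Real.log) :=
    Measure.isProbabilityMeasure_map Real.measurable_log.aemeasurable
  have hpos : ∀ᵐ y ∂ν, 0 < y := by
    rw [cdf_eq_real, measureReal_eq_zero_iff] at h0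
    filter_upwards [measure_eq_zero_iff_ae_notMem.1 h0] with y hy
    simpa using hy
  rw [cdf_eq_real, cdf_eq_real, map_measureReal_apply Real.measurable_log measurableSet_Iic]
  refine measureReal_congr ?_
  filter_upwards [hpos] with y hy
  exact propext (Real.log_le_iff_le_exp hy)

section Model

variable {Ω₀ : Type*} [MeasurableSpace Ω₀] {P₀ : Measure Ω₀} {X : Ω₀ → Fin d → ℝ} {Y : Ω₀ → ℝ}
  {κ : Kernel (Fin d → ℝ) ℝ} [IsMarkovKernel κ] {𝒳 : Set (Fin d → ℝ)} {β : ℝ → Fin (d + 1) → ℝ}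

lemma LogLinearQuantileModel.strictMono_cdf (h : LogLinearQuantileModel P₀ X Y κ 𝒳 β)
    {x : Fin d → ℝ} (hx : x ∈ 𝒳) : StrictMono (cdf ((κ x).map Real.log)) := fun a b hab => by
  rw [cdf_map_log (h.cdf_nonpos x hx 0 le_rfl), cdf_map_log (h.cdf_nonpos x hx 0 le_rfl)]
  exact h.cdf_increasing x hx (Real.exp_pos a) (Real.exp_pos b) (Real.exp_lt_exp.2 hab)

lemma LogLinearQuantileModel.continuous_cdf (h : LogLinearQuantileModel P₀ X Y κ 𝒳 β)
    {x : Fin d → ℝ} (hx : x ∈ 𝒳) : Continuous (cdf ((κ x).map Real.log)) := by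
  have e : (cdf ((κ x).map Real.log) : ℝ → ℝ) = fun z => cdf (κ x) (Real.exp z) :=
    funext (cdf_map_log (h.cdf_nonpos x hx 0 le_rfl))
  rw [e]
  exact (h.cdf_continuous x hx).comp_continuous Real.continuous_exp Real.exp_pos

/-- The linear predictor is the quantile also in the sense that the distribution function takes the
value `p` there. -/
lemma LogLinearQuantileModel.cdf_linPred (h : LogLinearQuantileModel P₀ X Y κ 𝒳 β)
    {x : Fin d → ℝ} (hx : x ∈ 𝒳) {p : ℝ} (hp : p ∈ Ioo (0 : ℝ) 1) :
    cdf ((κ x).map Real.log) (linPred (β p) x) = p := by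
  obtain ⟨q, hq⟩ := mem_range_of_exists_le_of_exists_ge (h.continuous_cdf hx)
    (((tendsto_cdf_atBot _).eventually_le_const hp.1).exists)
    (((tendsto_cdf_atTop _).eventually_const_le hp.2).exists)
  have hset : {t | p ≤ cdf ((κ x).map Real.log) t} = Ici q := by
    ext t
    rw [mem_ofPred_eq, mem_Ici, ← hq, (h.strictMono_cdf hx).le_iff_le]
  rw [← h.log_quantile x hx p hp, quantile, hset, csInf_Ici, hq]

lemma LogLinearQuantileModel.quantile_eq_plugInQ (h : LogLinearQuantileModel P₀ X Y κ 𝒳 β)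
    {x : Fin d → ℝ} (hx : x ∈ 𝒳) {p : ℝ} (hp : p ∈ Ioo (0 : ℝ) 1) :
    quantile (κ x) p = plugInQ β x p := by
  have hset : {t | p ≤ cdf (κ x) t} = Ici (Real.exp (linPred (β p) x)) := by
    ext t
    rw [mem_ofPred_eq, mem_Ici]
    rcases le_or_gt t 0 with ht | ht
    · rw [h.cdf_nonpos x hx t ht]
      exact iff_of_false (not_le.2 hp.1) (not_le.2 (ht.trans_lt (Real.exp_pos _)))
    · have := (h.strictMono_cdf hx).le_iff_le (a := linPred (β p) x) (b := Real.log t)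
      rw [h.cdf_linPred hx hp, cdf_map_log (h.cdf_nonpos x hx 0 le_rfl), Real.exp_log ht] at this
      rw [this, Real.le_log_iff_exp_le ht]
  rw [quantile, hset, csInf_Ici, plugInQ]

/-- The joint law of the covariates and the log-response. -/
noncomputable def jointLaw (P₀ : Measure Ω₀) (X : Ω₀ → Fin d → ℝ) (Y : Ω₀ → ℝ) :
    Measure (Obs d) :=
  P₀.map fun ω => (X ω, Real.log (Y ω))

/-- In the model `β p` is the only minimiser of the population objective at the level `p`: by
Knight's identity, conditionally on the covariates no predictor does better than the quantile, and
one that does as well agrees with it. -/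
lemma LogLinearQuantileModel.eq_of_integral_le [IsProbabilityMeasure P₀]
    (h : LogLinearQuantileModel P₀ X Y κ 𝒳 β)
    (hw : Integrable (fun w : Obs d => weight w.1) (jointLaw P₀ X Y))
    (hnd : ∀ v : Fin (d + 1) → ℝ, (∀ᵐ w ∂jointLaw P₀ X Y, linPred v w.1 = 0) → v = 0)
    {p : ℝ} (hp : p ∈ Ioo (0 : ℝ) 1) {b : Fin (d + 1) → ℝ}
    (hle : ∫ w, excessLoss (p, b) w ∂jointLaw P₀ X Y ≤
      ∫ w, excessLoss (p, β p) w ∂jointLaw P₀ X Y) : b = β p := by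
  have hXm := h.measurable_X
  have hZm : Measurable fun ω => Real.log (Y ω) := Real.measurable_log.comp h.measurable_Y
  have hlaw : jointLaw P₀ X Y = P₀.map X ⊗ₘ κ.map Real.log :=
    (h.condDistrib.comp_left Real.measurable_log).map_eq
  have hmk : IsMarkovKernel (κ.map Real.log) := Kernel.IsMarkovKernel.map κ Real.measurable_log
  have hPX : IsProbabilityMeasure (P₀.map X) := Measure.isProbabilityMeasure_map hXm.aemeasurable
  have hν : ∀ x, (κ.map Real.log) x = (κ x).map Real.log := fun x =>
    Kernel.map_apply κ Real.measurable_log x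
  set D : Obs d → ℝ := fun w => excessLoss (p, b) w - excessLoss (p, β p) w with hD
  have hDm : Measurable D := (measurable_excessLoss _).sub (measurable_excessLoss _)
  have i1 := integrable_excessLoss hw (θ := (p, b)) hp.1.le hp.2.le
  have i2 := integrable_excessLoss hw (θ := (p, β p)) hp.1.le hp.2.le
  have hDi : Integrable D (P₀.map X ⊗ₘ κ.map Real.log) := hlaw ▸ i1.sub i2
  have hD0 : ∫ w, D w ∂(P₀.map X ⊗ₘ κ.map Real.log) ≤ 0 := by
    rw [← hlaw, hD, integral_sub i1 i2]; linarith
  have hDe : ∀ x z, D (x, z) = rho p (z - linPred b x) - rho p (z - linPred (β p) x) :=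
    fun x z => by simp only [hD, excessLoss, residual]; ring
  set J : (Fin d → ℝ) → ℝ := fun x => ∫ z, D (x, z) ∂(κ.map Real.log) x with hJ
  have hJm : StronglyMeasurable J := hDm.stronglyMeasurable.integral_kernel_prod_right'
  have hw' : Integrable (weight : (Fin d → ℝ) → ℝ) (P₀.map X) := by
    have hwm : Measurable fun w : Obs d => weight w.1 := measurable_weight.comp measurable_fst
    rw [integrable_map_measure measurable_weight.aestronglyMeasurable hXm.aemeasurable]
    exact (integrable_map_measure hwm.aestronglyMeasurable (hXm.prodMk hZm).aemeasurable).1 hw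
  have hJi : Integrable J (P₀.map X) := by
    refine (hw'.const_mul ‖b - β p‖).mono' hJm.aestronglyMeasurable
      (Eventually.of_forall fun x => ?_)
    have := norm_integral_le_of_norm_le_const (μ := (κ.map Real.log) x)
      (f := fun z => D (x, z)) (C := ‖b - β p‖ * weight x) (Eventually.of_forall fun z => by
        rw [hDe, Real.norm_eq_abs]
        refine (abs_rho_sub_le hp.1.le hp.2.le _ _).trans ?_
        have e : z - linPred b x - (z - linPred (β p) x) = -linPred (b - β p) x := by
          rw [linPred_sub]; ring
        rw [e, abs_neg]
        exact abs_linPred_le _ _)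
    simpa using this
  -- the integration is transferred to `Ω₀`, as `𝒳` need not be measurable
  have hJXi : Integrable (fun ω => J (X ω)) P₀ :=
    (integrable_map_measure hJm.aestronglyMeasurable hXm.aemeasurable).1 hJi
  have hJX : ∫ ω, J (X ω) ∂P₀ ≤ 0 := by
    rw [← integral_map hXm.aemeasurable hJm.aestronglyMeasurable, hJ,
      ← Measure.integral_compProd hDi]
    exact hD0
  have hJe : ∀ x, J x = ∫ z, (rho p (z - linPred b x) - rho p (z - linPred (β p) x))
      ∂(κ x).map Real.log := fun x => by simp only [hJ, hDe, hν]
  have hprob : ∀ x, IsProbabilityMeasure ((κ x).map Real.log) := fun x =>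
    Measure.isProbabilityMeasure_map Real.measurable_log.aemeasurable
  have hJ0 : 0 ≤ᵐ[P₀] fun ω => J (X ω) := by
    filter_upwards [h.mem_values] with ω hω
    rw [hJe, (integral_rho_sub_rho hp.1.le hp.2.le (h.cdf_linPred hω hp) _).2]
    exact integral_nonneg (knightRemainder_nonneg _ _)
  have hz := (integral_eq_zero_iff_of_nonneg_ae hJ0 hJXi).1
    (le_antisymm hJX (integral_nonneg_of_ae hJ0))
  refine sub_eq_zero.1 (hnd _ ?_)
  have hlm : Measurable fun w : Obs d => linPred (b - β p) w.1 :=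
    (measurable_linPred _).comp measurable_fst
  refine (ae_map_iff (hXm.prodMk hZm).aemeasurable
    (measurableSet_eq_fun hlm measurable_const)).2 ?_
  filter_upwards [hz, h.mem_values] with ω hω hmem
  rw [hJe] at hω
  rw [linPred_sub, eq_of_integral_rho_sub_rho_eq_zero hp.1.le hp.2.le (h.cdf_linPred hmem hp)
    (h.strictMono_cdf hmem) hω, sub_self]

end Model

/-! ### From the coefficients to the quantile functions and inequality curves -/

lemma abs_exp_sub_exp_le {u v : ℝ} (h : |u - v| ≤ 1) :
    |Real.exp u - Real.exp v| ≤ 2 * Real.exp v * |u - v| := by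
  have e : Real.exp u - Real.exp v = Real.exp v * (Real.exp (u - v) - 1) := by
    rw [mul_sub, ← Real.exp_add]; ring_nf
  rw [e, abs_mul, abs_of_pos (Real.exp_pos v)]
  have := mul_le_mul_of_nonneg_left (Real.abs_exp_sub_one_le h) (Real.exp_pos v).le
  linarith

lemma qZ_plugInQ {b : ℝ → Fin (d + 1) → ℝ} {x : Fin d → ℝ} {p : ℝ} (hp : p ∈ Ioo (0 : ℝ) 1) :
    qZ (plugInQ b x) p =
      1 - Real.exp (linPred (b (p / 2)) x - linPred (b (1 / 2 + p / 2)) x) := by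
  rw [qZ, if_neg (by rintro (h | h) <;> linarith [hp.1, hp.2]), plugInQ, plugInQ, Real.exp_sub]

lemma continuousOn_qZ_plugInQ {b : ℝ → Fin (d + 1) → ℝ} {η : ℝ} (hη : 0 < η)
    (hb : ContinuousOn b (Icc (η / 2) (1 - η / 2))) (x : Fin d → ℝ) :
    ContinuousOn (qZ (plugInQ b x)) (Icc η (1 - η)) := by
  have hlin : ContinuousOn (fun p => linPred (b p) x) (Icc (η / 2) (1 - η / 2)) := by
    rw [continuousOn_pi] at hb
    exact (hb 0).add (continuousOn_finsetSum _ fun i _ => (hb i.succ).mul continuousOn_const)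
  refine ContinuousOn.congr (f := fun p => 1 -
    Real.exp (linPred (b (p / 2)) x - linPred (b (1 / 2 + p / 2)) x)) ?_
    fun p hp => qZ_plugInQ ⟨by linarith [hp.1], by linarith [hp.2]⟩
  refine continuousOn_const.sub (Real.continuous_exp.comp_continuousOn (ContinuousOn.sub ?_ ?_))
  · exact hlin.comp (by fun_prop) fun p hp => ⟨by linarith [hp.1], by linarith [hp.1, hp.2]⟩
  · exact hlin.comp (by fun_prop) fun p hp => ⟨by linarith [hp.1, hp.2], by linarith [hp.2]⟩

section Convergence

variable {Ω : Type*} [MeasurableSpace Ω] {P : Measure Ω}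

/-- An event in `m`, `n` and `ω` that, for `m` beyond a deterministic bound, is contained in one of
high probability as `n → ∞`, has probability tending to `1` as `m, n → ∞` jointly. -/
lemma tendsto_measure_not {S : ℕ → ℕ × Ω → Prop}
    (h : ∃ M, ∀ᶠ q in highProb P, ∀ m ≥ M, S m q) :
    Tendsto (fun mn : ℕ × ℕ => P {ω | ¬ S mn.1 (mn.2, ω)}) (atTop ×ˢ atTop) (𝓝 0) := by
  obtain ⟨M, hM⟩ := h
  refine tendsto_of_tendsto_of_tendsto_of_le_of_le' tendsto_const_nhds
    ((eventually_highProb.1 hM).comp tendsto_snd) (Eventually.of_forall fun _ => zero_le) ?_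
  filter_upwards [tendsto_fst.eventually (eventually_ge_atTop M)] with mn hmn
  refine measure_mono fun ω hω => ?_
  rw [mem_ofPred_eq] at hω ⊢
  exact fun hall => hω (hall _ hmn)

lemma tendstoInProbUniformlyOn_of_eventually {E : Type*} [PseudoMetricSpace E]
    {F : ℕ → ℕ → Ω → ℝ → E} {f : ℝ → E} {S : Set ℝ}
    (h : ∀ ε : ℝ, 0 < ε → ∃ M, ∀ᶠ q in highProb P, ∀ m ≥ M, ∀ p ∈ S,
      dist (F m q.1 q.2 p) (f p) ≤ ε) :
    TendstoInProbUniformlyOn P F f S := by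
  intro ε hε
  obtain ⟨r, hr0, hr⟩ := ENNReal.lt_iff_exists_nnreal_btwn.1 hε
  have hr0' : (0 : ℝ) < r := by exact_mod_cast hr0
  refine tendsto_of_tendsto_of_tendsto_of_le_of_le tendsto_const_nhds
    (tendsto_measure_not (h r hr0')) (fun _ => zero_le) fun mn => measure_mono fun ω hω => ?_
  rw [mem_ofPred_eq] at hω ⊢
  intro hall
  refine absurd (hω.trans (iSup₂_le fun p hp => ?_)) (not_le.2 hr)
  rw [edist_nndist]
  exact_mod_cast hall p hp

lemma tendstoInMeasure_of_eventually {F : ℕ → ℕ → Ω → ℝ} {a : ℝ}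
    (h : ∀ ε : ℝ, 0 < ε → ∃ M, ∀ᶠ q in highProb P, ∀ m ≥ M, |F m q.1 q.2 - a| ≤ ε) :
    TendstoInMeasure P (fun (mn : ℕ × ℕ) ω => F mn.1 mn.2 ω) (atTop ×ˢ atTop) fun _ => a := by
  intro ε hε
  obtain ⟨r, hr0, hr⟩ := ENNReal.lt_iff_exists_nnreal_btwn.1 hε
  have hr0' : (0 : ℝ) < r := by exact_mod_cast hr0
  refine tendsto_of_tendsto_of_tendsto_of_le_of_le tendsto_const_nhds
    (tendsto_measure_not (h r hr0')) (fun _ => zero_le) fun mn => measure_mono fun ω hω => ?_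
  rw [mem_ofPred_eq] at hω ⊢
  intro hall
  refine absurd hω (not_le.2 (lt_of_le_of_lt ?_ hr))
  rw [edist_nndist]
  exact_mod_cast (Real.dist_eq (F mn.1 mn.2 ω) a).trans_le hall

lemma abs_exp_sub_exp_le_of_close {u v R δ ε : ℝ} (hv : v ≤ R) (huv : |u - v| ≤ δ) (hδ : δ ≤ 1)
    (hδε : 2 * Real.exp R * δ ≤ ε) : |Real.exp u - Real.exp v| ≤ ε := by
  refine (abs_exp_sub_exp_le (huv.trans hδ)).trans (le_trans ?_ hδε)
  gcongr

/-- Uniform closeness of interpolated estimates of `β` on each `[η, 1 - η]` implies all the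
consistency properties. The inequality curve on `[η, 1 - η]` involves the coefficients on
`[η / 2, 1 - η / 2]` only. -/
theorem consistent_of_eventually_close {κ : Kernel (Fin d → ℝ) ℝ} {𝒳 : Set (Fin d → ℝ)}
    {β : ℝ → Fin (d + 1) → ℝ} {b : ℕ → ℕ → Ω → ℝ → Fin (d + 1) → ℝ}
    (hβ : ∀ η ∈ Ioo (0 : ℝ) (1 / 2), ContinuousOn β (Icc η (1 - η)))
    (hκ : ∀ x ∈ 𝒳, ∀ p ∈ Ioo (0 : ℝ) 1, quantile (κ x) p = plugInQ β x p)
    (hb : ∀ m n ω i, IsLinearInterpolation m fun p => b m n ω p i)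
    (h : ∀ η ∈ Ioo (0 : ℝ) (1 / 2), ∀ ε : ℝ, 0 < ε → ∃ M, ∀ᶠ q in highProb P, ∀ m ≥ M,
      ∀ p ∈ Icc η (1 - η), ‖b m q.1 q.2 p - β p‖ ≤ ε) :
    Consistent P κ 𝒳 β b := by
  intro η hη
  have hη0 := hη.1
  have hη2 : η / 2 ∈ Ioo (0 : ℝ) (1 / 2) := ⟨by linarith, by linarith [hη.2]⟩
  refine ⟨tendstoInProbUniformlyOn_of_eventually fun ε hε => ?_, fun x hx => ?_⟩
  · simpa only [dist_eq_norm] using h η hη ε hε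
  have hwt := weight_nonneg x
  obtain ⟨B, hB⟩ :=
    (isCompact_Icc.image_of_continuousOn (hβ _ hη2)).isBounded.exists_norm_le
  have hlinB : ∀ p ∈ Icc (η / 2) (1 - η / 2), |linPred (β p) x| ≤ B * weight x := fun p hp =>
    (abs_linPred_le _ _).trans (by gcongr; exact hB _ (mem_image_of_mem β hp))
  have hlin : ∀ (c : ℝ → Fin (d + 1) → ℝ) (p δ : ℝ), ‖c p - β p‖ ≤ δ →
      |linPred (c p) x - linPred (β p) x| ≤ δ * weight x := fun c p δ hc => by
    rw [← linPred_sub]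
    exact (abs_linPred_le _ _).trans (by gcongr)
  have hsub : ∀ p ∈ Icc η (1 - η), p ∈ Icc (η / 2) (1 - η / 2) ∧
      p / 2 ∈ Icc (η / 2) (1 - η / 2) ∧ 1 / 2 + p / 2 ∈ Icc (η / 2) (1 - η / 2) :=
    fun p hp => ⟨⟨by linarith [hp.1], by linarith [hp.2]⟩,
      ⟨by linarith [hp.1], by linarith [hp.1, hp.2]⟩,
      ⟨by linarith [hp.1, hp.2], by linarith [hp.2]⟩⟩
  have h01 : ∀ p ∈ Icc (η / 2) (1 - η / 2), p ∈ Ioo (0 : ℝ) 1 := fun p hp =>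
    ⟨by linarith [hp.1], by linarith [hp.2]⟩
  -- a tolerance for the coefficients that is good enough for the exponentials
  have hδ : ∀ ε : ℝ, 0 < ε → ∃ δ > 0, 2 * (δ * weight x) ≤ 1 ∧
      2 * Real.exp (2 * (B * weight x)) * (2 * (δ * weight x)) ≤ ε := fun ε hε => by
    set E := Real.exp (2 * (B * weight x)) with hE
    have hE0 : 0 < E := Real.exp_pos _
    refine ⟨min (1 / (2 * (weight x + 1))) (ε / (4 * E * (weight x + 1))), by positivity, ?_, ?_⟩
    · calc _ ≤ 2 * (1 / (2 * (weight x + 1)) * (weight x + 1)) := by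
            gcongr
            · exact min_le_left _ _
            · linarith
        _ = 1 := by field_simp
    · calc _ ≤ 2 * E * (2 * (ε / (4 * E * (weight x + 1)) * (weight x + 1))) := by
            gcongr
            · exact min_le_right _ _
            · linarith
        _ = ε := by field_simp; ring
  have hBw : ∀ p ∈ Icc (η / 2) (1 - η / 2), 0 ≤ B * weight x := fun p hp =>
    (abs_nonneg _).trans (hlinB p hp)
  have hqκ : ∀ p ∈ Icc η (1 - η), qZ (quantile (κ x)) p = qZ (plugInQ β x) p := fun p hp => by
    simp only [qZ]
    rw [hκ x hx _ (h01 _ (hsub p hp).2.1), hκ x hx _ (h01 _ (hsub p hp).2.2)]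
  have hqZ : ∀ ε : ℝ, 0 < ε → ∃ M, ∀ᶠ q in highProb P, ∀ m ≥ M, ∀ p ∈ Icc η (1 - η),
      |qZ (plugInQ (b m q.1 q.2) x) p - qZ (quantile (κ x)) p| ≤ ε := fun ε hε => by
    obtain ⟨δ, hδ0, hδ1, hδ2⟩ := hδ ε hε
    obtain ⟨M, hM⟩ := h _ hη2 δ hδ0
    refine ⟨M, hM.mono fun q hq m hm p hp => ?_⟩
    obtain ⟨hp1, hp2, hp3⟩ := hsub p hp
    rw [hqκ p hp, qZ_plugInQ (h01 p hp1), qZ_plugInQ (h01 p hp1), sub_sub_sub_cancel_left,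
      abs_sub_comm]
    refine abs_exp_sub_exp_le_of_close ?_ ?_ hδ1 hδ2
    · linarith [(abs_le.1 (hlinB _ hp2)).2, (abs_le.1 (hlinB _ hp3)).1]
    · have a1 := abs_le.1 (hlin _ _ _ (hq m hm _ hp2))
      have a2 := abs_le.1 (hlin _ _ _ (hq m hm _ hp3))
      rw [abs_le]
      constructor <;> linarith [a1.1, a1.2, a2.1, a2.2]
  refine ⟨tendstoInProbUniformlyOn_of_eventually fun ε hε => ?_,
    tendstoInProbUniformlyOn_of_eventually fun ε hε => ?_,
    tendstoInMeasure_of_eventually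
      (F := fun m n ω => ∫ p in η..(1 - η), qZ (plugInQ (b m n ω) x) p) fun ε hε => ?_⟩
  · obtain ⟨δ, hδ0, hδ1, hδ2⟩ := hδ ε hε
    obtain ⟨M, hM⟩ := h _ hη2 δ hδ0
    refine ⟨M, hM.mono fun q hq m hm p hp => ?_⟩
    have hp1 := (hsub p hp).1
    rw [hκ x hx p (h01 p hp1), Real.dist_eq, plugInQ, plugInQ]
    have hδw : 0 ≤ δ * weight x := by positivity
    refine abs_exp_sub_exp_le_of_close ?_ ?_ hδ1 hδ2
    · linarith [(abs_le.1 (hlinB _ hp1)).2, hBw p hp1]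
    · exact (hlin _ _ _ (hq m hm _ hp1)).trans (by linarith)
  · simpa only [Real.dist_eq] using hqZ ε hε
  · obtain ⟨M, hM⟩ := hqZ ε hε
    obtain ⟨M', hM'⟩ := exists_nat_gt (2 / η)
    refine ⟨max M M', hM.mono fun q hq m hm => ?_⟩
    have hmM : M ≤ m := (le_max_left _ _).trans hm
    have hmM' : (M' : ℝ) ≤ m := by exact_mod_cast (le_max_right _ _).trans hm
    have hm0 : (0 : ℝ) < m := (by positivity : 0 < 2 / η).trans (hM'.trans_le hmM')
    have hmη : 1 / (m : ℝ) ≤ η / 2 := by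
      have := hM'.le.trans hmM'
      rw [div_le_iff₀ hη0] at this
      rw [div_le_iff₀ hm0]
      linarith
    have hle : η ≤ 1 - η := by linarith [hη.2]
    have hbc : ContinuousOn (b m q.1 q.2) (Icc (η / 2) (1 - η / 2)) := by
      rw [continuousOn_pi]
      intro i
      refine (hb m q.1 q.2 i).continuousOn.mono (Icc_subset_Icc hmη ?_)
      have : ((m : ℝ) - 1) / m = 1 - 1 / m := by field_simp
      rw [this]
      linarith
    have i1 : IntervalIntegrable (qZ (plugInQ (b m q.1 q.2) x)) volume η (1 - η) := by
      refine ContinuousOn.intervalIntegrable ?_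
      rw [uIcc_of_le hle]
      exact continuousOn_qZ_plugInQ hη0 hbc x
    have i2 : IntervalIntegrable (qZ (quantile (κ x))) volume η (1 - η) := by
      refine ContinuousOn.intervalIntegrable ?_
      rw [uIcc_of_le hle]
      exact (continuousOn_qZ_plugInQ hη0 (hβ _ hη2) x).congr hqκ
    rw [← intervalIntegral.integral_sub i1 i2, ← Real.norm_eq_abs]
    refine (intervalIntegral.norm_integral_le_of_norm_le_const (C := ε) fun p hp => ?_).trans ?_
    · rw [uIoc_of_le hle] at hp
      exact hq m hmM p ⟨hp.1.le, hp.2⟩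
    · rw [abs_of_nonneg (by linarith)]
      nlinarith

end Convergence

end CondQuantile

/-! ### Consistency in the model -/

theorem mainTheorem1 {Ω₀ Ω : Type*} [MeasurableSpace Ω₀] [MeasurableSpace Ω]
    (P₀ : Measure Ω₀) [IsProbabilityMeasure P₀] (P : Measure Ω) [IsProbabilityMeasure P]
    {d : ℕ} (X : Ω₀ → Fin d → ℝ) (Y : Ω₀ → ℝ)
    (κ : Kernel (Fin d → ℝ) ℝ) [IsMarkovKernel κ] (𝒳 : Set (Fin d → ℝ))
    (β : ℝ → Fin (d + 1) → ℝ)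
    (hmodel : CondQuantile.LogLinearQuantileModel P₀ X Y κ 𝒳 β)
    -- the independent copies of `(X, Y)`
    (Xs : ℕ → Ω → Fin d → ℝ) (Ys : ℕ → Ω → ℝ)
    (hXs : ∀ k, Measurable (Xs k)) (hYs : ∀ k, Measurable (Ys k))
    (hindep : iIndepFun (fun k ω => (Xs k ω, Ys k ω)) P)
    (hident : ∀ k, IdentDistrib (fun ω => (Xs k ω, Ys k ω)) (fun ω => (X ω, Y ω)) P P₀)
    (hA1 : CondQuantile.CovariateDensity (P₀.map X))
    (hA2 : CondQuantile.HolderLogDensity κ 𝒳)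
    (hA3 : CondQuantile.DesignConverges P Xs)
    -- the OQR and the IOQR estimators, with an arbitrary choice of the minimisers
    (βhat βtil : ℕ → ℕ → Ω → ℝ → Fin (d + 1) → ℝ)
    (hhat : ∀ m n ω, CondQuantile.IsOQREstimate m n (fun k => Xs k ω)
      (fun k => Real.log (Ys k ω)) (βhat m n ω))
    (htil : ∀ m n ω, CondQuantile.IsIsotonised m (βhat m n ω) (βtil m n ω)) :
    CondQuantile.Consistent P κ 𝒳 β βhat ∧
      (Integrable (fun ω => Real.log (Y ω)) P₀ → CondQuantile.Consistent P κ 𝒳 β βtil) := by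
  open CondQuantile in
  set W : ℕ → Ω → Obs d := fun k ω => (Xs k ω, Real.log (Ys k ω))
  set μ := jointLaw P₀ X Y
  have hlog : Measurable fun w : Obs d => (w.1, Real.log w.2) :=
    measurable_fst.prodMk (Real.measurable_log.comp measurable_snd)
  have hZm : Measurable fun ω => Real.log (Y ω) := Real.measurable_log.comp hmodel.measurable_Y
  have hpair := hmodel.measurable_X.prodMk hZm
  have : IsProbabilityMeasure μ := Measure.isProbabilityMeasure_map hpair.aemeasurable
  have hl : ObeysLLN μ ((highProb P).map (sampleOf W)) :=
    obeysLLN_of_iid (fun k => (hXs k).prodMk (Real.measurable_log.comp (hYs k)))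
      (hindep.comp (fun _ w => (w.1, Real.log w.2)) fun _ => hlog)
      fun k => ((hident k).comp hlog).map_eq
  obtain ⟨A, hpos, hA⟩ := hA3.exists_tendsto fun k ω => Real.log (Ys k ω)
  have hwt := hl.integrable_weight hA
  have hβc : ∀ η ∈ Ioo (0 : ℝ) (1 / 2), ContinuousOn β (Icc η (1 - η)) := fun η hη =>
    continuousOn_pi.2 fun i => hmodel.coef_continuous i η hη
  have hnd : ∀ v : Fin (d + 1) → ℝ, (∀ᵐ w ∂μ, linPred v w.1 = 0) → v = 0 := fun v hv =>
    hl.eq_zero_of_linPred_ae_eq_zero hpos hA hv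
  have hpop : IsQuantilePopulation μ β :=
    ⟨hwt, hnd, fun p hp b hb => hmodel.eq_of_integral_le hwt hnd hp hb, hβc⟩
  have hκ : ∀ x ∈ 𝒳, ∀ p ∈ Ioo (0 : ℝ) 1, quantile (κ x) p = plugInQ β x p :=
    fun x hx p hp => hmodel.quantile_eq_plugInQ hx hp
  refine ⟨consistent_of_eventually_close hβc hκ (fun m n ω => (hhat m n ω).2)
    fun η hη ε hε => ?_, fun hint => consistent_of_eventually_close hβc hκ
    (fun m n ω i => (htil m n ω i).2) fun η hη ε hε => ?_⟩
  · obtain ⟨M, hM⟩ := hl.exists_eventually_estimate_close hpop hη hε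
    exact ⟨M, (eventually_map.1 hM).mono fun q hq m hm => hq m hm _ (hhat m q.1 q.2)⟩
  · have hz : Integrable (fun w : Obs d => w.2) μ :=
      (integrable_map_measure measurable_snd.aestronglyMeasurable hpair.aemeasurable).2 hint
    obtain ⟨M, hM⟩ :=
      hl.exists_eventually_isotonised_close hpop hmodel.coef_monotone hz hη hε
    exact ⟨M, (eventually_map.1 hM).mono fun q hq m hm =>
      hq m hm _ _ (hhat m q.1 q.2) (htil m q.1 q.2)⟩
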